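/- **Proposition 1.12.** Let $E$ and $E_0$ be elliptic curves over $\mathbb{Q}$, let $\varphi: E \to E_0$ be a $\mathbb{Q}$-isogeny of degree $2$ with dual isogeny $\varphi': E_0 \to E$, and let $d$ be a nonzero integer. Write $E^d$ and $E_0^d$ for the quadratic twists by $d$ (for $E: y^2 = x^3+ax+b$, the twist $E^d$ is $y^2 = x^3 + d^2ax+d^3b$), write $E^d[\varphi]$ for the kernel of the isogeny $E^d \to E_0^d$ associated to $\varphi$, and $E_0^d[\varphi']$ for the kernel of the isogeny $E_0^d \to E^d$ associated to $\varphi'$. For an elliptic curve $A/\mathbb{Q}$, let $$\mathrm{Sel}^{2^\infty} A = \ker\Big(H^1(G_{\mathbb{Q}}, A[2^\infty]) \to \prod_v H^1(G_{\mathbb{Q}_v}, A)\Big),$$ the product being over all places $v$ of $\mathbb{Q}$, and let $\mathrm{Sel}^{2^\infty}_{\mathrm{div}} A$ be its subgroup of divisible elements. For $k \ge 1$ let $r_{2^k}(A)$ be the maximal $r$ such that $(\mathbb{Z}/2^k\mathbb{Z})^r$ embeds into $\mathrm{Sel}^{2^\infty} A$, and let $r_{2^\infty}(A) = \lim_{k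 \to \infty} r_{2^k}(A)$. Finally, let $$r_{\varphi,\mathrm{div}}(E^d) = \dim_{\mathbb{F}_2}\Big(\mathrm{im}\big(H^1(G_{\mathbb{Q}}, E^d[\varphi]) \to H^1(G_{\mathbb{Q}}, E^d[2^\infty])\big) \cap \mathrm{Sel}^{2^\infty}_{\mathrm{div}} E^d\Big),$$ and define $r_{\varphi',\mathrm{div}}(E_0^d)$ in the same way. Then, for $A = E^d$ and for $A = E_0^d$, the maxima and the limit defining $r_{2^\infty}(A)$ exist, the two $\mathbb{F}_2$-vector spaces above are finite-dimensional, and $$r_{2^\infty}(E^d) = r_{2^\infty}(E_0^d) = r_{\varphi,\mathrm{div}}(E^d) + r_{\varphi',\mathrm{div}}(E_0^d).$$ -/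

import Mathlib

noncomputable section

open scoped Classical Polynomial.Bivariate

/-! ### Continuous cohomology in degree one -/

namespace ContH1

variable (G : Type*) [Group G] [TopologicalSpace G]
variable (M : Type*) [AddCommGroup M] [DistribMulAction G M]

/-- Continuous 1-cocycles of `G` with values in the discrete `G`-module `M`; a function to a
discrete space is continuous exactly when it is locally constant. -/
def cocycles : AddSubgroup (G → M) where
  carrier := {f | IsLocallyConstant f ∧ ∀ g h, f (g * h) = f g + g • f h}
  zero_mem' := ⟨IsLocallyConstant.const 0, fun g h => by simp⟩
  add_mem' := by
    rintro a b ⟨ha, ha'⟩ ⟨hb, hb'⟩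
    refine ⟨ha.add hb, fun g h => ?_⟩
    simp only [Pi.add_apply, ha', hb', smul_add]
    abel
  neg_mem' := by
    rintro a ⟨ha, ha'⟩
    refine ⟨ha.neg, fun g h => ?_⟩
    simp only [Pi.neg_apply, ha', smul_neg]
    abel

/-- The 1-coboundaries `g ↦ g • m - m`. -/
def coboundaries : AddSubgroup (G → M) where
  carrier := {f | ∃ m : M, ∀ g, f g = g • m - m}
  zero_mem' := ⟨0, fun g => by simp⟩
  add_mem' := by
    rintro a b ⟨m, hm⟩ ⟨n, hn⟩
    refine ⟨m + n, fun g => ?_⟩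
    simp only [Pi.add_apply, hm, hn, smul_add]
    abel
  neg_mem' := by
    rintro a ⟨m, hm⟩
    refine ⟨-m, fun g => ?_⟩
    simp only [Pi.neg_apply, hm, smul_neg]
    abel

end ContH1

/-- The continuous cohomology group `H¹(G, M)` of a discrete `G`-module `M`. -/
abbrev ContH1 (G : Type*) [Group G] [TopologicalSpace G]
    (M : Type*) [AddCommGroup M] [DistribMulAction G M] : Type _ :=
  ContH1.cocycles G M ⧸ (ContH1.coboundaries G M).addSubgroupOf (ContH1.cocycles G M)

namespace ContH1

variable {G : Type*} [Group G] [TopologicalSpace G]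
variable {M : Type*} [AddCommGroup M] [DistribMulAction G M]
variable {H : Type*} [Group H] [TopologicalSpace H]
variable {N : Type*} [AddCommGroup N] [DistribMulAction H N]

/-- The map on cocycles `f ↦ j ∘ f ∘ r` induced by a continuous homomorphism `r : H → G` and an
additive map `j : M → N` compatible with the actions. -/
def cocyclesMap (r : H →* G) (hr : Continuous r) (j : M →+ N)
    (hj : ∀ (h : H) (m : M), j (r h • m) = h • j m) : cocycles G M →+ cocycles H N where
  toFun f := ⟨fun h => j (f.1 (r h)),
    (f.2.1.comp_continuous hr).comp j, fun g h => by
      simp only [map_mul, f.2.2, map_add, hj]⟩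
  map_zero' := by ext h; simp
  map_add' a b := by ext h; simp

/-- The map `H¹(G, M) → H¹(H, N)` induced by a continuous homomorphism `r : H → G` and an
additive map `j : M → N` compatible with the actions. -/
def map (r : H →* G) (hr : Continuous r) (j : M →+ N)
    (hj : ∀ (h : H) (m : M), j (r h • m) = h • j m) : ContH1 G M →+ ContH1 H N :=
  QuotientAddGroup.map _ _ (cocyclesMap r hr j hj) (by
    rintro ⟨f, hf⟩ ⟨m, hm⟩
    refine ⟨j m, fun h => ?_⟩
    have := hm (r h)
    simp only [AddSubgroup.coe_subtype] at this
    simp only [AddSubgroup.coe_subtype, cocyclesMap, AddMonoidHom.coe_mk, ZeroHom.coe_mk,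
      this, map_sub, hj])

lemma nsmul_eq_zero (n : ℕ) (h : ∀ m : M, n • m = 0) (c : ContH1 G M) : n • c = 0 := by
  obtain ⟨f, rfl⟩ := QuotientAddGroup.mk_surjective c
  rw [← QuotientAddGroup.mk_nsmul]
  have : n • f = 0 := by
    ext g
    simp [h]
  rw [this, QuotientAddGroup.mk_zero]

end ContH1

/-- The subgroup of those elements of `A` that are divisible, inside `A`, by every positive
integer. -/
def AddSubgroup.divisibleElements {B : Type*} [AddCommGroup B] (A : AddSubgroup B) :
    AddSubgroup B where
  carrier := {x | x ∈ A ∧ ∀ n : ℕ, 0 < n → ∃ y ∈ A, n • y = x}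
  zero_mem' := ⟨A.zero_mem, fun n _ => ⟨0, A.zero_mem, by simp⟩⟩
  add_mem' := by
    rintro a b ⟨ha, ha'⟩ ⟨hb, hb'⟩
    refine ⟨A.add_mem ha hb, fun n hn => ?_⟩
    obtain ⟨y, hy, rfl⟩ := ha' n hn
    obtain ⟨z, hz, rfl⟩ := hb' n hn
    exact ⟨y + z, A.add_mem hy hz, by simp⟩
  neg_mem' := by
    rintro a ⟨ha, ha'⟩
    refine ⟨A.neg_mem ha, fun n hn => ?_⟩
    obtain ⟨y, hy, rfl⟩ := ha' n hn
    exact ⟨-y, A.neg_mem hy, by simp⟩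

/-! ### Absolute Galois groups and restriction to a place -/

section Galois

variable (K : Type) [Field K]

/-- The absolute Galois group, with its Krull topology. -/
abbrev AbsGal : Type := AlgebraicClosure K ≃ₐ[K] AlgebraicClosure K

variable {K} {k : Type} [Field k] [Algebra K k]

/-- The homomorphism `Gal(k̄/k) → Gal(K̄/K)` determined by a `K`-embedding `ι : K̄ → k̄`:
the restriction `τ` of `σ` is the automorphism with `ι (τ x) = σ (ι x)`. -/
def AbsGal.restrict (ι : AlgebraicClosure K →ₐ[K] AlgebraicClosure k) :
    AbsGal k →* AbsGal K :=
  letI : Algebra (AlgebraicClosure K) (AlgebraicClosure k) := ι.toRingHom.toAlgebra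
  haveI : IsScalarTower K (AlgebraicClosure K) (AlgebraicClosure k) :=
    IsScalarTower.of_algebraMap_eq fun x => (ι.commutes x).symm
  (AlgEquiv.restrictNormalHom (AlgebraicClosure K)).comp (AlgEquiv.restrictScalarsHom K)

lemma AbsGal.restrict_spec (ι : AlgebraicClosure K →ₐ[K] AlgebraicClosure k)
    (σ : AbsGal k) (x : AlgebraicClosure K) : ι (AbsGal.restrict ι σ x) = σ (ι x) := by
  let : Algebra (AlgebraicClosure K) (AlgebraicClosure k) := ι.toRingHom.toAlgebra
  have : IsScalarTower K (AlgebraicClosure K) (AlgebraicClosure k) :=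
    IsScalarTower.of_algebraMap_eq fun x => (ι.commutes x).symm
  exact AlgEquiv.restrictNormal_commutes (AlgEquiv.restrictScalars K σ) (AlgebraicClosure K) x

lemma AbsGal.continuous_restrict
    (ι : AlgebraicClosure K →ₐ[K] AlgebraicClosure k) : Continuous (AbsGal.restrict ι) := by
  refine continuous_of_continuousAt_one _ ?_
  rw [ContinuousAt, map_one, Filter.tendsto_def]
  intro s hs
  rw [krullTopology_mem_nhds_one_iff] at hs ⊢
  obtain ⟨F, hF, hFs⟩ := hs
  obtain ⟨S, hS⟩ := IntermediateField.fg_of_fg_toSubalgebra F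
    (Subalgebra.fg_of_fg_toSubmodule ((Submodule.fg_iff_finiteDimensional _).2 hF))
  refine ⟨IntermediateField.adjoin k (ι '' (S : Set (AlgebraicClosure K))), ?_, ?_⟩
  · have : Finite (ι '' (S : Set (AlgebraicClosure K))) :=
      (S.finite_toSet.image ι).to_subtype
    exact IntermediateField.finiteDimensional_adjoin fun x _ =>
      Algebra.IsIntegral.isIntegral x
  · intro σ hσ
    refine hFs ?_
    rw [SetLike.mem_coe, ← hS, IntermediateField.mem_fixingSubgroup_iff]
    have key : ∀ x ∈ (S : Set (AlgebraicClosure K)), AbsGal.restrict ι σ x = x := by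
      intro x hx
      refine ι.injective ((AbsGal.restrict_spec ι σ x).trans ?_)
      exact (IntermediateField.mem_fixingSubgroup_iff _ _).1 hσ _
        (IntermediateField.subset_adjoin k _ ⟨x, hx, rfl⟩)
    intro x hx
    induction hx using IntermediateField.adjoin_induction with
    | mem x hx => exact key x hx
    | algebraMap x => exact AlgEquiv.commutes _ x
    | add x y _ _ hx hy => rw [map_add, hx, hy]
    | inv x _ hx => rw [map_inv₀, hx]
    | mul x y _ _ hx hy => rw [map_mul, hx, hy]

end Galois

/-! ### Points of elliptic curves and isogenies -/

namespace WeierstrassCurve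

variable {K : Type} [Field K]

/-- The group `W(L)` of points over an extension field `L`. -/
abbrev Pts (W : WeierstrassCurve K) (L : Type) [Field L] [Algebra K L] : Type :=
  (Affine.baseChange W.toAffine L).Point

/-- The map `W(L) → W(L')` induced by a `K`-embedding `L → L'`. -/
abbrev Pts.map (W : WeierstrassCurve K) {L L' : Type} [Field L] [Algebra K L] [Field L']
    [Algebra K L'] (f : L →ₐ[K] L') : W.Pts L →+ W.Pts L' :=
  Affine.Point.map (W' := W.toAffine) f

/-- The coordinatewise action of `Gal(L/k)` on `W(L)`, for `K ⊆ k ⊆ L`. -/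
instance (W : WeierstrassCurve K) (k L : Type) [Field k] [Field L] [Algebra K k] [Algebra K L]
    [Algebra k L] [IsScalarTower K k L] : DistribMulAction (L ≃ₐ[k] L) (W.Pts L) where
  smul σ P := Pts.map W ((σ : L →ₐ[k] L).restrictScalars K) P
  one_smul P := by
    rcases P with _ | _ <;> rfl
  mul_smul σ τ P := by
    rcases P with _ | _ <;> rfl
  smul_zero σ := _root_.map_zero _
  smul_add σ P Q := _root_.map_add _ P Q

lemma Pts.smul_def (W : WeierstrassCurve K) {k L : Type} [Field k] [Field L] [Algebra K k]
    [Algebra K L] [Algebra k L] [IsScalarTower K k L] (σ : L ≃ₐ[k] L) (P : W.Pts L) :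
    σ • P = Pts.map W ((σ : L →ₐ[k] L).restrictScalars K) P := rfl

/-- An isogeny `E → E₀` over `K`, through its effect on points over extension fields of `K`:
a homomorphism `E(L) → E₀(L)` for every extension `L/K`, compatible with `K`-embeddings of
extensions, and given by rational functions `(a/c, b/c)` in the affine coordinates with
coefficients in `K`, where `c` does not vanish identically on `E`. The last condition makes it
a morphism of curves over `K`, and rules out the constant map to the point at infinity. -/
structure Isogeny (E E₀ : WeierstrassCurve K) where
  /-- the homomorphism on `L`-points -/
  hom : ∀ (L : Type) [Field L] [Algebra K L], E.Pts L →+ E₀.Pts L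
  hom_map : ∀ (L L' : Type) [Field L] [Algebra K L] [Field L'] [Algebra K L'] (f : L →ₐ[K] L')
    (P : E.Pts L), hom L' (Pts.map E f P) = Pts.map E₀ f (hom L P)
  rational : ∃ a b c : K[X][Y], Affine.CoordinateRing.mk E.toAffine c ≠ 0 ∧
    ∀ (L : Type) [Field L] [Algebra K L] (x y : L)
      (h : (Affine.baseChange E.toAffine L).Nonsingular x y),
      (c.map (Polynomial.mapRingHom (algebraMap K L))).evalEval x y ≠ 0 →
      ∃ h₀, hom L (.some x y h) = .some
        ((a.map (Polynomial.mapRingHom (algebraMap K L))).evalEval x y /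
          (c.map (Polynomial.mapRingHom (algebraMap K L))).evalEval x y)
        ((b.map (Polynomial.mapRingHom (algebraMap K L))).evalEval x y /
          (c.map (Polynomial.mapRingHom (algebraMap K L))).evalEval x y) h₀

/-- The degree of an isogeny in characteristic zero, as the order of its geometric kernel. -/
def Isogeny.degree [CharZero K] {E E₀ : WeierstrassCurve K} (φ : Isogeny E E₀) : ℕ :=
  Nat.card (φ.hom (AlgebraicClosure K)).ker

/-- `φ' : E₀ → E` is the dual isogeny to `φ : E → E₀`: the compositions `φ' ∘ φ` and `φ ∘ φ'` are
multiplication by `deg φ` on `E` and on `E₀`. -/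
def Isogeny.IsDual [CharZero K] {E E₀ : WeierstrassCurve K} (φ : Isogeny E E₀)
    (φ' : Isogeny E₀ E) : Prop :=
  (∀ (L : Type) [Field L] [Algebra K L] (P : E.Pts L),
    φ'.hom L (φ.hom L P) = φ.degree • P) ∧
  ∀ (L : Type) [Field L] [Algebra K L] (Q : E₀.Pts L),
    φ.hom L (φ'.hom L Q) = φ.degree • Q

/-- The geometric kernel of `φ` is killed by `2`. -/
def Isogeny.KerTwo {E E₀ : WeierstrassCurve K} (φ : Isogeny E E₀) : Prop :=
  ∀ P : E.Pts (AlgebraicClosure K), φ.hom (AlgebraicClosure K) P = 0 → 2 • P = 0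

/-- An isogeny of degree `2` has kernel killed by `2`. -/
lemma Isogeny.kerTwo [CharZero K] {E E₀ : WeierstrassCurve K} {φ : Isogeny E E₀}
    (h : φ.degree = 2) : φ.KerTwo := by
  intro P hP
  have : Nat.card (φ.hom (AlgebraicClosure K)).ker • (⟨P, hP⟩ : (φ.hom (AlgebraicClosure K)).ker) = 0 :=
    card_nsmul_eq_zero'
  rw [show Nat.card (φ.hom (AlgebraicClosure K)).ker = 2 from h] at this
  exact congrArg Subtype.val this

/-- The dual of an isogeny of degree `2` has kernel killed by `2`. -/
lemma Isogeny.IsDual.kerTwo [CharZero K] {E E₀ : WeierstrassCurve K} {φ : Isogeny E E₀}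
    {φ' : Isogeny E₀ E} (h' : φ.IsDual φ') (h : φ.degree = 2) : φ'.KerTwo := by
  intro Q hQ
  rw [← h, ← h'.2, hQ, _root_.map_zero]

/-! ### Quadratic twists -/

/-- The quadratic twist `E^d`. Completing the square in the equation of `E` gives
`y² = x³ + (b₂/4) x² + (b₄/2) x + b₆/4`, and `E^d` is
`y² = x³ + d (b₂/4) x² + d² (b₄/2) x + d³ (b₆/4)`. For `E : y² = x³ + a x + b` this is
`y² = x³ + d² a x + d³ b`. -/
def twist (E : WeierstrassCurve K) (d : K) : WeierstrassCurve K where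
  a₁ := 0
  a₂ := d * (E.b₂ / 4)
  a₃ := 0
  a₄ := d ^ 2 * (E.b₄ / 2)
  a₆ := d ^ 3 * (E.b₆ / 4)

lemma twist_short [CharZero K] (a b d : K) :
    twist ⟨0, 0, 0, a, b⟩ d = ⟨0, 0, 0, d ^ 2 * a, d ^ 3 * b⟩ := by
  ext <;> simp [twist, b₂, b₄, b₆]

lemma twist_Δ [CharZero K] (E : WeierstrassCurve K) (d : K) : (E.twist d).Δ = d ^ 6 * E.Δ := by
  simp only [twist, Δ, b₂, b₄, b₆, b₈]
  field_simp
  ring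

section twist

variable [CharZero K] (E : WeierstrassCurve K) {d : K} {L : Type} [Field L] [Algebra K L]

lemma twist_nonsingular (hd : d ≠ 0) {s : L} (hs : s ^ 2 = algebraMap K L d) {x y : L}
    (h : (Affine.baseChange E.toAffine L).Nonsingular x y) :
    (Affine.baseChange (E.twist d).toAffine L).Nonsingular (s ^ 2 * x)
      (s ^ 3 * (y + (algebraMap K L E.a₁ * x + algebraMap K L E.a₃) / 2)) := by
  have : CharZero L := charZero_of_injective_algebraMap (algebraMap K L).injective
  have hs0 : s ≠ 0 := by
    rintro rfl
    exact hd ((map_eq_zero (algebraMap K L)).1 (by simpa using hs.symm))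
  rw [Affine.nonsingular_iff'] at h ⊢
  simp only [Affine.equation_iff, Affine.baseChange, toAffine, WeierstrassCurve.map, baseChange,
    twist, b₂, b₄, b₆, map_mul, map_add, map_pow, map_div₀, map_ofNat, map_zero, ← hs] at h ⊢
  generalize algebraMap K L E.a₁ = a₁ at *
  generalize algebraMap K L E.a₂ = a₂ at *
  generalize algebraMap K L E.a₃ = a₃ at *
  generalize algebraMap K L E.a₄ = a₄ at *
  generalize algebraMap K L E.a₆ = a₆ at *
  obtain ⟨h, h'⟩ := h
  refine ⟨by linear_combination s ^ 6 * h, ?_⟩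
  by_contra hcon
  push Not at hcon
  obtain ⟨h1, h2⟩ := hcon
  have e2 : 2 * y + a₁ * x + a₃ = 0 := by
    have : s ^ 3 * (2 * y + a₁ * x + a₃) = 0 := by linear_combination h2
    exact (mul_eq_zero.1 this).resolve_left (pow_ne_zero _ hs0)
  have e1 : a₁ * y - (3 * x ^ 2 + 2 * a₂ * x + a₄) = 0 := by
    have : s ^ 4 * (a₁ * y - (3 * x ^ 2 + 2 * a₂ * x + a₄)) = 0 := by
      linear_combination h1 + s ^ 4 * a₁ / 2 * e2
    exact (mul_eq_zero.1 this).resolve_left (pow_ne_zero _ hs0)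
  exact h'.elim (fun t => t e1) (fun t => t e2)

lemma twist_nonsingular_inv (hd : d ≠ 0) {s : L} (hs : s ^ 2 = algebraMap K L d) {x y : L}
    (h : (Affine.baseChange (E.twist d).toAffine L).Nonsingular x y) :
    (Affine.baseChange E.toAffine L).Nonsingular (x / s ^ 2)
      (y / s ^ 3 - (algebraMap K L E.a₁ * (x / s ^ 2) + algebraMap K L E.a₃) / 2) := by
  have : CharZero L := charZero_of_injective_algebraMap (algebraMap K L).injective
  have hs0 : s ≠ 0 := by
    rintro rfl
    exact hd ((map_eq_zero (algebraMap K L)).1 (by simpa using hs.symm))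
  obtain ⟨x, rfl⟩ : ∃ x', x = s ^ 2 * x' := ⟨x / s ^ 2, by field_simp⟩
  obtain ⟨y, rfl⟩ : ∃ y', y = s ^ 3 * y' := ⟨y / s ^ 3, by field_simp⟩
  rw [mul_div_cancel_left₀ _ (pow_ne_zero _ hs0), mul_div_cancel_left₀ _ (pow_ne_zero _ hs0)]
  rw [Affine.nonsingular_iff'] at h ⊢
  simp only [Affine.equation_iff, Affine.baseChange, toAffine, WeierstrassCurve.map, baseChange,
    twist, b₂, b₄, b₆, map_mul, map_add, map_pow, map_div₀, map_ofNat, map_zero, ← hs] at h ⊢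
  generalize algebraMap K L E.a₁ = a₁ at *
  generalize algebraMap K L E.a₂ = a₂ at *
  generalize algebraMap K L E.a₃ = a₃ at *
  generalize algebraMap K L E.a₄ = a₄ at *
  generalize algebraMap K L E.a₆ = a₆ at *
  obtain ⟨h, h'⟩ := h
  refine ⟨mul_left_cancel₀ (pow_ne_zero 6 hs0) (by linear_combination h), ?_⟩
  by_contra hcon
  push Not at hcon
  obtain ⟨h1, h2⟩ := hcon
  have e2 : y = 0 := by linear_combination h2 / 2
  subst e2
  rcases h' with t | t
  · exact t (by linear_combination s ^ 4 * h1)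
  · exact t (by ring)

lemma twist_negY {s : L} (x y : L) :
    (Affine.baseChange (E.twist d).toAffine L).negY (s ^ 2 * x)
      (s ^ 3 * (y + (algebraMap K L E.a₁ * x + algebraMap K L E.a₃) / 2)) =
    s ^ 3 * ((Affine.baseChange E.toAffine L).negY x y +
      (algebraMap K L E.a₁ * x + algebraMap K L E.a₃) / 2) := by
  have : CharZero L := charZero_of_injective_algebraMap (algebraMap K L).injective
  simp only [Affine.negY, Affine.baseChange, toAffine, WeierstrassCurve.map, baseChange,
    twist, map_zero]
  ring

lemma twist_slope (hd : d ≠ 0) {s : L} (hs : s ^ 2 = algebraMap K L d) {x₁ x₂ y₁ y₂ : L}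
    (h₁ : (Affine.baseChange E.toAffine L).Equation x₁ y₁)
    (h₂ : (Affine.baseChange E.toAffine L).Equation x₂ y₂)
    (h : ¬(x₁ = x₂ ∧ y₁ = (Affine.baseChange E.toAffine L).negY x₂ y₂)) :
    (Affine.baseChange (E.twist d).toAffine L).slope (s ^ 2 * x₁) (s ^ 2 * x₂)
      (s ^ 3 * (y₁ + (algebraMap K L E.a₁ * x₁ + algebraMap K L E.a₃) / 2))
      (s ^ 3 * (y₂ + (algebraMap K L E.a₁ * x₂ + algebraMap K L E.a₃) / 2)) =
    s * ((Affine.baseChange E.toAffine L).slope x₁ x₂ y₁ y₂ + algebraMap K L E.a₁ / 2) := by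
  have : CharZero L := charZero_of_injective_algebraMap (algebraMap K L).injective
  have hs0 : s ≠ 0 := by
    rintro rfl
    exact hd ((map_eq_zero (algebraMap K L)).1 (by simpa using hs.symm))
  by_cases hx : x₁ = x₂
  · subst hx
    have hy : y₁ ≠ (Affine.baseChange E.toAffine L).negY x₁ y₂ := fun t => h ⟨rfl, t⟩
    have hy' : s ^ 3 * (y₁ + (algebraMap K L E.a₁ * x₁ + algebraMap K L E.a₃) / 2) ≠
        (Affine.baseChange (E.twist d).toAffine L).negY (s ^ 2 * x₁)
          (s ^ 3 * (y₂ + (algebraMap K L E.a₁ * x₁ + algebraMap K L E.a₃) / 2)) := by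
      rw [twist_negY]
      exact fun t => hy (add_right_cancel (mul_left_cancel₀ (pow_ne_zero 3 hs0) t))
    rw [Affine.slope_of_Y_ne rfl hy', Affine.slope_of_Y_ne rfl hy, twist_negY]
    have hz : y₁ - (Affine.baseChange E.toAffine L).negY x₁ y₁ ≠ 0 := by
      rw [sub_ne_zero]
      have hyy := Affine.Y_eq_of_Y_ne h₁ h₂ rfl hy
      rwa [← hyy] at hy
    have hz' : s ^ 3 * (y₁ + (algebraMap K L E.a₁ * x₁ + algebraMap K L E.a₃) / 2) -
        s ^ 3 * ((Affine.baseChange E.toAffine L).negY x₁ y₁ +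
          (algebraMap K L E.a₁ * x₁ + algebraMap K L E.a₃) / 2) ≠ 0 := by
      intro t
      refine hz (mul_left_cancel₀ (pow_ne_zero 3 hs0) ?_)
      linear_combination t
    rw [div_eq_iff hz', show algebraMap K L E.a₁ / 2 =
      algebraMap K L E.a₁ / 2 * (y₁ - (Affine.baseChange E.toAffine L).negY x₁ y₁) /
        (y₁ - (Affine.baseChange E.toAffine L).negY x₁ y₁) by field_simp, ← add_div]
    rw [mul_div_assoc', div_mul_eq_mul_div, eq_div_iff hz]
    simp only [Affine.negY, Affine.baseChange, toAffine, WeierstrassCurve.map, baseChange,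
      twist, b₂, b₄, map_mul, map_add, map_pow, map_div₀, map_ofNat, map_zero, ← hs]
    ring
  · have hx' : s ^ 2 * x₁ ≠ s ^ 2 * x₂ := fun t => hx (mul_left_cancel₀ (pow_ne_zero 2 hs0) t)
    rw [Affine.slope_of_X_ne hx', Affine.slope_of_X_ne hx]
    have := sub_ne_zero.2 hx
    have := sub_ne_zero.2 hx'
    field_simp
    ring

/-- The isomorphism `E(L) ≃ E^d(L)` for a field `L` containing a square root `s` of `d`:
`(x, y) ↦ (s² x, s³ (y + (a₁ x + a₃) / 2))`, where `s² = d`. -/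
def twistEquiv (hd : d ≠ 0) {s : L} (hs : s ^ 2 = algebraMap K L d) :
    E.Pts L ≃+ (E.twist d).Pts L where
  toFun P := match P with
    | .zero => .zero
    | .some _ _ h => .some _ _ (E.twist_nonsingular hd hs h)
  invFun P := match P with
    | .zero => .zero
    | .some _ _ h => .some _ _ (E.twist_nonsingular_inv hd hs h)
  left_inv P := by
    have hs0 : s ≠ 0 := by
      rintro rfl
      exact hd ((map_eq_zero (algebraMap K L)).1 (by simpa using hs.symm))
    rcases P with _ | ⟨x, y, h⟩
    · rfl
    · simp only [Affine.Point.some.injEq]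
      rw [mul_div_cancel_left₀ _ (pow_ne_zero _ hs0), mul_div_cancel_left₀ _ (pow_ne_zero _ hs0)]
      exact ⟨rfl, by ring⟩
  right_inv P := by
    have hs0 : s ≠ 0 := by
      rintro rfl
      exact hd ((map_eq_zero (algebraMap K L)).1 (by simpa using hs.symm))
    rcases P with _ | ⟨x, y, h⟩
    · rfl
    · simp only [Affine.Point.some.injEq]
      exact ⟨by field_simp, by field_simp; ring⟩
  map_add' := by
    have : CharZero L := charZero_of_injective_algebraMap (algebraMap K L).injective
    have hs0 : s ≠ 0 := by
      rintro rfl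
      exact hd ((map_eq_zero (algebraMap K L)).1 (by simpa using hs.symm))
    rintro (_ | ⟨x₁, y₁, h₁⟩) (_ | ⟨x₂, y₂, h₂⟩)
    any_goals rfl
    by_cases hxy : x₁ = x₂ ∧ y₁ = (Affine.baseChange E.toAffine L).negY x₂ y₂
    · rw [Affine.Point.add_of_Y_eq hxy.1 hxy.2]
      refine (Affine.Point.add_of_Y_eq (by rw [hxy.1]) ?_).symm
      rw [twist_negY, ← hxy.2, hxy.1]
    · have hxy' : ¬(s ^ 2 * x₁ = s ^ 2 * x₂ ∧
          s ^ 3 * (y₁ + (algebraMap K L E.a₁ * x₁ + algebraMap K L E.a₃) / 2) =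
          (Affine.baseChange (E.twist d).toAffine L).negY (s ^ 2 * x₂)
            (s ^ 3 * (y₂ + (algebraMap K L E.a₁ * x₂ + algebraMap K L E.a₃) / 2))) := by
        rw [twist_negY]
        rintro ⟨t₁, t₂⟩
        have t₁ := mul_left_cancel₀ (pow_ne_zero 2 hs0) t₁
        have t₂ := mul_left_cancel₀ (pow_ne_zero 3 hs0) t₂
        rw [t₁] at t₂
        exact hxy ⟨t₁, add_right_cancel t₂⟩
      rw [Affine.Point.add_some hxy]
      refine Eq.trans ?_ (Affine.Point.add_some hxy').symm
      simp only [Affine.Point.some.injEq]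
      rw [twist_slope E hd hs h₁.1 h₂.1 hxy]
      generalize (Affine.baseChange E.toAffine L).slope x₁ x₂ y₁ y₂ = ℓ
      simp only [Affine.addX, Affine.addY, Affine.negAddY, Affine.negY, Affine.baseChange,
        toAffine, WeierstrassCurve.map, baseChange, twist, b₂, map_mul, map_add, map_pow,
        map_div₀, map_ofNat, map_zero, ← hs]
      exact ⟨by ring, by ring⟩

lemma twist_isElliptic [E.IsElliptic] (hd : d ≠ 0) : (E.twist d).IsElliptic :=
  ⟨by rw [twist_Δ]; exact ((hd.isUnit).pow 6).mul E.isUnit_Δ⟩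

lemma smul_twistEquiv (hd : d ≠ 0) {s : L} (hs : s ^ 2 = algebraMap K L d) (σ : L ≃ₐ[K] L)
    (h : σ s = s) (P : E.Pts L) : σ • twistEquiv E hd hs P = twistEquiv E hd hs (σ • P) := by
  have h2 : σ (2 : L) = 2 := map_ofNat σ 2
  rcases P with _ | ⟨x, y, hP⟩
  · rfl
  · refine (Affine.Point.some.injEq ..).mpr ?_
    simp [h, h2]

lemma smul_twistEquiv' (hd : d ≠ 0) {s : L} (hs : s ^ 2 = algebraMap K L d) (σ : L ≃ₐ[K] L)
    (h : σ s = -s) (P : E.Pts L) : σ • twistEquiv E hd hs P = -twistEquiv E hd hs (σ • P) := by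
  have : CharZero L := charZero_of_injective_algebraMap (algebraMap K L).injective
  have h2 : σ (2 : L) = 2 := map_ofNat σ 2
  rcases P with _ | ⟨x, y, hP⟩
  · rfl
  · refine Eq.trans ?_ (Affine.Point.neg_some ..).symm
    refine (Affine.Point.some.injEq ..).mpr ?_
    rw [twist_negY]
    simp only [Affine.negY, Affine.baseChange, toAffine, WeierstrassCurve.map, baseChange]
    simp [h, h2]
    ring

end twist

/-- A square root of `d` in the algebraic closure. -/
def sqrtClosure (d : K) : AlgebraicClosure K :=
  (IsAlgClosed.exists_pow_nat_eq (algebraMap K (AlgebraicClosure K) d) two_pos).choose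

lemma sqrtClosure_sq (d : K) : sqrtClosure d ^ 2 = algebraMap K (AlgebraicClosure K) d :=
  (IsAlgClosed.exists_pow_nat_eq (algebraMap K (AlgebraicClosure K) d) two_pos).choose_spec

namespace Isogeny

variable [CharZero K] {E E₀ : WeierstrassCurve K} (φ : Isogeny E E₀) {d : K} (hd : d ≠ 0)

/-- The isogeny `E^d → E₀^d` associated to `φ : E → E₀`, on geometric points: the conjugate of `φ`
by the isomorphisms `E ≃ E^d` and `E₀ ≃ E₀^d` given by one and the same square root of `d`. -/
def twistHom : (E.twist d).Pts (AlgebraicClosure K) →+ (E₀.twist d).Pts (AlgebraicClosure K) :=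
  ((twistEquiv E₀ hd (sqrtClosure_sq d)).toAddMonoidHom.comp (φ.hom (AlgebraicClosure K))).comp
    (twistEquiv E hd (sqrtClosure_sq d)).symm.toAddMonoidHom

/-- The associated isogeny of twists commutes with the Galois action. -/
lemma twistHom_smul (σ : AbsGal K) (Q : (E.twist d).Pts (AlgebraicClosure K)) :
    φ.twistHom hd (σ • Q) = σ • φ.twistHom hd Q := by
  have hφ : ∀ P, φ.hom (AlgebraicClosure K) (σ • P) = σ • φ.hom (AlgebraicClosure K) P :=
    fun P => φ.hom_map _ _ _ P
  obtain ⟨P, rfl⟩ := (twistEquiv E hd (sqrtClosure_sq d)).surjective Q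
  have key : ∀ P, φ.twistHom hd (twistEquiv E hd (sqrtClosure_sq d) P) =
      twistEquiv E₀ hd (sqrtClosure_sq d) (φ.hom (AlgebraicClosure K) P) := by
    intro P
    simp [twistHom]
  rw [key]
  have h : σ (sqrtClosure d) ^ 2 = sqrtClosure d ^ 2 := by
    rw [← map_pow, sqrtClosure_sq, AlgEquiv.commutes]
  rcases sq_eq_sq_iff_eq_or_eq_neg.1 h with h | h
  · rw [smul_twistEquiv E hd _ σ h, smul_twistEquiv E₀ hd _ σ h, key, hφ]
  · rw [smul_twistEquiv' E hd _ σ h, smul_twistEquiv' E₀ hd _ σ h, map_neg, key, hφ]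

/-- The Galois module `E^d[φ]`, the kernel of the associated isogeny `E^d → E₀^d`. -/
abbrev twistKer : AddSubgroup ((E.twist d).Pts (AlgebraicClosure K)) := (φ.twistHom hd).ker

instance : DistribMulAction (AbsGal K) (φ.twistKer hd) where
  smul σ P := ⟨σ • P.1, by
    rw [AddMonoidHom.mem_ker, twistHom_smul, (AddMonoidHom.mem_ker).1 P.2, smul_zero]⟩
  one_smul P := Subtype.ext (one_smul _ P.1)
  mul_smul σ τ P := Subtype.ext (mul_smul σ τ P.1)
  smul_zero σ := Subtype.ext (smul_zero σ)
  smul_add σ P Q := Subtype.ext (smul_add σ P.1 Q.1)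

lemma two_nsmul_twistKer (h : φ.KerTwo) (P : φ.twistKer hd) : 2 • P = 0 := by
  have h₁ := h _ ((AddEquiv.map_eq_zero_iff (twistEquiv E₀ hd (sqrtClosure_sq d))).1
    ((AddMonoidHom.mem_ker).1 P.2))
  refine Subtype.ext ?_
  rw [← map_nsmul] at h₁
  exact (AddEquiv.map_eq_zero_iff _).1 h₁

end Isogeny

/-! ### Selmer groups -/

/-- The Galois module `W[2^∞]`. -/
def twoPowTorsion (W : WeierstrassCurve K) : AddSubgroup (W.Pts (AlgebraicClosure K)) where
  carrier := {P | ∃ n : ℕ, 2 ^ n • P = 0}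
  zero_mem' := ⟨0, by simp⟩
  add_mem' := by
    rintro P Q ⟨m, hm⟩ ⟨n, hn⟩
    refine ⟨m + n, ?_⟩
    rw [smul_add, pow_add, mul_smul _ _ Q, hn, mul_comm, mul_smul _ _ P, hm]
    simp
  neg_mem' := by
    rintro P ⟨m, hm⟩
    exact ⟨m, by rw [smul_neg, hm, neg_zero]⟩

instance (W : WeierstrassCurve K) : DistribMulAction (AbsGal K) W.twoPowTorsion where
  smul σ P := ⟨σ • P.1, by
    obtain ⟨n, hn⟩ := P.2
    exact ⟨n, by rw [smul_comm, hn, smul_zero]⟩⟩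
  one_smul P := Subtype.ext (one_smul _ P.1)
  mul_smul σ τ P := Subtype.ext (mul_smul σ τ P.1)
  smul_zero σ := Subtype.ext (smul_zero σ)
  smul_add σ P Q := Subtype.ext (smul_add σ P.1 Q.1)

/-- For an extension `k/K` and a `K`-embedding `ι : K̄ → k̄`, the localization map
`H¹(G_K, W[2^∞]) → H¹(G_k, W(k̄))`. -/
def localization (W : WeierstrassCurve K) (k : Type) [Field k] [Algebra K k]
    (ι : AlgebraicClosure K →ₐ[K] AlgebraicClosure k) :
    ContH1 (AbsGal K) W.twoPowTorsion →+ ContH1 (AbsGal k) (W.Pts (AlgebraicClosure k)) :=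
  ContH1.map (AbsGal.restrict ι) (AbsGal.continuous_restrict ι)
    ((Pts.map W ι).comp W.twoPowTorsion.subtype) (by
      rintro σ ⟨P, hP⟩
      rcases P with _ | ⟨x, y, h⟩
      · rfl
      · refine (Affine.Point.some.injEq ..).mpr ?_
        exact ⟨AbsGal.restrict_spec ι σ x, AbsGal.restrict_spec ι σ y⟩)

/-- The `2^∞`-Selmer group of `W/ℚ`: the classes in `H¹(G_ℚ, W[2^∞])` that become trivial in
`H¹(G_{ℚ_v}, W)` at every place `v` of `ℚ`. (Triviality does not depend on the embedding of
`ℚ̄` into the algebraic closure of `ℚ_v`; all embeddings are used.) -/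
def selmer (W : WeierstrassCurve ℚ) : AddSubgroup (ContH1 (AbsGal ℚ) W.twoPowTorsion) :=
  (⨅ ι, (W.localization ℝ ι).ker) ⊓
    ⨅ (p : ℕ) (_ : Fact p.Prime), ⨅ ι, (W.localization ℚ_[p] ι).ker

/-- The set of `r` such that `(ℤ/2^k)^r` embeds into the `2^∞`-Selmer group of `W`. -/
def selmerRankSet (W : WeierstrassCurve ℚ) (k : ℕ) : Set ℕ :=
  {r | ∃ f : (Fin r → ZMod (2 ^ k)) →+ W.selmer, Function.Injective f}

/-- The `2^k`-Selmer rank `r_{2^k}(W)`: the maximal `r` such that `(ℤ/2^k)^r` embeds into the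
`2^∞`-Selmer group. -/
def selmerRank (W : WeierstrassCurve ℚ) (k : ℕ) : ℕ := sSup (W.selmerRankSet k)

/-- The `2^∞`-Selmer corank `r_{2^∞}(W) = lim_k r_{2^k}(W)`. -/
def selmerCorank (W : WeierstrassCurve ℚ) : ℕ := Filter.limUnder Filter.atTop W.selmerRank

/-- The maximum and the limit in the definition of the `2^∞`-Selmer corank exist. -/
def SelmerCorankExists (W : WeierstrassCurve ℚ) : Prop :=
  (∀ k : ℕ, 0 < k → IsGreatest (W.selmerRankSet k) (W.selmerRank k)) ∧
    Filter.Tendsto W.selmerRank Filter.atTop (nhds W.selmerCorank)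

namespace Isogeny

variable {E E₀ : WeierstrassCurve ℚ} (φ : Isogeny E E₀) (h : φ.KerTwo) {d : ℚ} (hd : d ≠ 0)

/-- The map `H¹(G_ℚ, E^d[φ]) → H¹(G_ℚ, E^d[2^∞])` induced by the inclusion, for `φ` with
kernel killed by `2`. -/
def kerToTorsion :
    ContH1 (AbsGal ℚ) (φ.twistKer hd) →+ ContH1 (AbsGal ℚ) (E.twist d).twoPowTorsion :=
  ContH1.map (MonoidHom.id _) continuous_id
    (AddSubgroup.inclusion (fun P hP => ⟨1, by
      simpa using congrArg Subtype.val (φ.two_nsmul_twistKer hd h ⟨P, hP⟩)⟩))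
    (fun _ _ => rfl)

/-- The intersection of the image of `H¹(G_ℚ, E^d[φ])` in `H¹(G_ℚ, E^d[2^∞])` with the subgroup of
divisible elements of the `2^∞`-Selmer group of `E^d`. -/
def divPart : AddSubgroup (ContH1 (AbsGal ℚ) (E.twist d).twoPowTorsion) :=
  (φ.kerToTorsion h hd).range ⊓ (E.twist d).selmer.divisibleElements

instance : Module (ZMod 2) (φ.divPart h hd) :=
  AddCommGroup.zmodModule (n := 2) (by
    rintro ⟨_, ⟨c, rfl⟩, hc⟩
    refine Subtype.ext ?_
    change 2 • φ.kerToTorsion h hd c = 0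
    rw [← map_nsmul, ContH1.nsmul_eq_zero 2 (φ.two_nsmul_twistKer hd h), map_zero])

/-- The dimension `r_{φ,div}(E^d)` over `𝔽₂`. -/
def divRank : ℕ := Module.finrank (ZMod 2) (φ.divPart h hd)

end Isogeny

end WeierstrassCurve

end

/-! ### Ranks of socles of abelian groups -/

namespace AddSubgroup

/-! Let `ψ` and `ψ'` be the two isogenies between the twists. Both composites are multiplication by
`2`, also on `H¹`. Since `ψ` and `ψ'` extend compatibly to points over local fields
(`extendsLocally_twistHom`), they induce maps between the Selmer groups `S` and `S₀`, hence between
their subgroups `D` and `D₀` of divisible elements.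

Suppose that `S[2]` and `S₀[2]` are finite. The rank `r_{2^(k+1)}` is the dimension of `S[2] ∩ 2^k
S`. These subgroups decrease with `k` and stabilize at `D[2]`, so the maxima and the limit exist and
the corank is the dimension of `D[2]` (`selmerCorankExists_and_two_pow_selmerCorank`). Next, `ψ`
maps `D[2]` to `D₀[ψ']` with kernel `D[ψ]`. This map is onto: `D₀` is `2`-divisible, so an element
of `D₀[ψ']` is `2c = ψ(ψ' c)` with `c` in `D₀` (`card_twoTorsion_divisibleElements`). Thus `2^corank
= |D[ψ]| * |D₀[ψ']|`. Exchanging the curves only swaps the factors, so the coranks agree. Finally,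
since `ψ` is onto on geometric points, the kernel of `ψ` on `H¹` is the image of the cohomology of
`ker ψ`, so `D[ψ]` is the space whose dimension is wanted (`divPart_eq`).

It remains to prove finiteness, which reduces to that of `S[ψ]` and `S₀[ψ']`
(`finite_selmer_inf_ker`). Such a class comes from a cocycle with values in a Galois-stable group
`{0, T}`, that is, from a quadratic character, attached to some `√m`. If it is trivial at `p`,
explicit descent shows that, up to squares in `ℚ_p`, `m` is `1` or a value of the descent map on the
`2`-isogenous curve `w² = X(X² - 2aX + D)`. For `a` integral and `D` a unit at `p`, this makes the
valuation of `m` even. Only finitely many square classes have even valuation outside a fixed finite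
set of primes. -/

/-- The elements of `A` killed by `2` that are divisible by `2 ^ k` in `A`. -/
def divSocle (A : Type*) [AddCommGroup A] (k : ℕ) : AddSubgroup A where
  carrier := {x | 2 • x = 0 ∧ ∃ y, 2 ^ k • y = x}
  zero_mem' := ⟨smul_zero _, 0, smul_zero _⟩
  add_mem' := by
    rintro a b ⟨ha, y, rfl⟩ ⟨hb, z, rfl⟩
    exact ⟨by rw [smul_add, ha, hb, add_zero], y + z, smul_add _ _ _⟩
  neg_mem' := by
    rintro a ⟨ha, y, rfl⟩
    exact ⟨by rw [smul_neg, ha, neg_zero], -y, smul_neg _ _⟩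

variable {A : Type*} [AddCommGroup A]

lemma divSocle_antitone : Antitone (divSocle A) := by
  rintro k l hkl x ⟨hx, y, rfl⟩
  refine ⟨hx, 2 ^ (l - k) • y, ?_⟩
  rw [smul_smul, ← pow_add, Nat.add_sub_cancel' hkl]

lemma finite_divSocle (h : {x : A | 2 • x = 0}.Finite) (k : ℕ) : Finite (divSocle A k) :=
  (h.subset fun _ hx => hx.1).to_subtype

/-- The vectors with entries `0` or `2 ^ k` in `(ℤ/2^(k+1))^r` form its `2`-torsion, all divisible
by `2 ^ k`; an embedding carries these `2 ^ r` vectors into the socle. -/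
lemma two_pow_le_card_divSocle (h : {x : A | 2 • x = 0}.Finite) {k r : ℕ}
    {f : (Fin r → ZMod (2 ^ (k + 1))) →+ A} (hf : Function.Injective f) :
    2 ^ r ≤ Nat.card (divSocle A k) := by
  have := finite_divSocle h k
  let g : (Fin r → Fin 2) → divSocle A k := fun v =>
    ⟨f (fun i => ((2 ^ k * (v i).val : ℕ) : ZMod (2 ^ (k + 1)))), by
      constructor
      · rw [← map_nsmul]
        convert map_zero f
        ext i
        simp only [Pi.smul_apply, Pi.zero_apply, nsmul_eq_mul]
        rw [← Nat.cast_mul, ZMod.natCast_eq_zero_iff]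
        exact ⟨(v i).val, by ring⟩
      · refine ⟨f (fun i => ((v i).val : ZMod (2 ^ (k + 1)))), ?_⟩
        rw [← map_nsmul]
        congr 1
        ext i
        simp⟩
  have hg : Function.Injective g := by
    intro v w hvw
    have h1 := hf (congrArg Subtype.val hvw)
    funext i
    have h2 := congrFun h1 i
    rw [ZMod.natCast_eq_natCast_iff] at h2
    have hpos : 0 < 2 ^ k := by positivity
    have h3 := Nat.ModEq.eq_of_lt_of_lt h2 (by have := (v i).2; rw [pow_succ]; gcongr)
      (by have := (w i).2; rw [pow_succ]; gcongr)
    exact Fin.ext (Nat.eq_of_mul_eq_mul_left hpos h3)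
  simpa using Nat.card_le_card_of_injective g hg

/-- Choose `r` independent vectors of the socle over `𝔽₂` and write each as `2 ^ k • y i`. The `y i`
then generate a free `ℤ/2^(k+1)`-module. -/
lemma exists_injective_of_two_pow_le (h : {x : A | 2 • x = 0}.Finite) {k r : ℕ}
    (hr : 2 ^ r ≤ Nat.card (divSocle A k)) :
    ∃ f : (Fin r → ZMod (2 ^ (k + 1))) →+ A, Function.Injective f := by
  have := finite_divSocle h k
  let : Module (ZMod 2) (divSocle A k) :=
    AddCommGroup.zmodModule (n := 2) (fun x => Subtype.ext x.2.1)
  have hn : Nat.card (divSocle A k) = 2 ^ Module.finrank (ZMod 2) (divSocle A k) := by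
    rw [Module.natCard_eq_pow_finrank (K := ZMod 2), Nat.card_zmod]
  rw [hn, Nat.pow_le_pow_iff_right one_lt_two] at hr
  obtain ⟨e, he⟩ := exists_linearIndependent_of_le_finrank hr
  choose y hy using fun i => (e i).2.2
  have hind : ∀ n : Fin r → ℤ, ∑ i, n i • (2 ^ k • y i) = 0 → ∀ i, (2 : ℤ) ∣ n i := by
    intro n hn i
    have h0 : ∑ i, ((n i : ℤ) : ZMod 2) • e i = 0 := by
      refine Subtype.ext ?_
      simp only [Int.cast_smul_eq_zsmul, AddSubgroup.val_finsetSum, AddSubgroup.coe_zsmul]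
      simpa [hy] using hn
    have := Fintype.linearIndependent_iff.1 he _ h0 i
    exact (ZMod.intCast_zmod_eq_zero_iff_dvd _ 2).1 this
  have hkill : ∀ i, (zmultiplesHom A (y i)) ((2 ^ (k + 1) : ℕ) : ℤ) = 0 := by
    intro i
    rw [zmultiplesHom_apply, natCast_zsmul, pow_succ', mul_smul, hy]
    exact (e i).2.1
  -- Once all coefficients are `2 ^ j * c i`, multiplying the relation by `2 ^ (k - j)` gives a
  -- relation among the independent vectors `2 ^ k • y i`, so every `c i` is even.
  have hdvd : ∀ n : Fin r → ℤ, ∑ i, n i • y i = 0 →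
      ∀ j ≤ k + 1, ∀ i, (2 ^ j : ℤ) ∣ n i := by
    intro n hn j
    induction j with
    | zero => simp
    | succ j ih =>
      intro hj
      choose c hc using ih (by lia)
      intro i
      rw [hc i, pow_succ]
      refine mul_dvd_mul_left _ (hind c ?_ i)
      have hkj : (2 ^ k : ℕ) = 2 ^ (k - j) * 2 ^ j := by
        rw [← pow_add]; congr 1; lia
      rw [← smul_zero (2 ^ (k - j) : ℕ), ← hn, Finset.smul_sum]
      refine Finset.sum_congr rfl fun i _ => ?_
      rw [hc i, hkj, ← natCast_zsmul, ← natCast_zsmul, smul_smul, smul_smul]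
      congr 1
      push_cast
      ring
  let g : Fin r → ZMod (2 ^ (k + 1)) →+ A := fun i => ZMod.lift _ ⟨zmultiplesHom A (y i), hkill i⟩
  refine ⟨∑ i, (g i).comp (Pi.evalAddMonoidHom _ i), ?_⟩
  rw [injective_iff_map_eq_zero]
  intro a ha
  choose n hn using fun i => ZMod.intCast_surjective (a i)
  have hz : ∑ i, n i • y i = 0 := by
    rw [← ha, AddMonoidHom.finsetSum_apply]
    refine Finset.sum_congr rfl fun i _ => ?_
    simp [g, ← hn]
  ext i
  rw [← hn, Pi.zero_apply, ZMod.intCast_zmod_eq_zero_iff_dvd]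
  exact_mod_cast hdvd n hz (k + 1) le_rfl i

lemma exists_injective_iff (h : {x : A | 2 • x = 0}.Finite) {k r : ℕ} :
    (∃ f : (Fin r → ZMod (2 ^ (k + 1))) →+ A, Function.Injective f) ↔
      r ≤ Nat.log 2 (Nat.card (divSocle A k)) := by
  have := finite_divSocle h k
  rw [Nat.le_log_iff_pow_le one_lt_two Nat.card_pos.ne']
  exact ⟨fun ⟨_, hf⟩ => two_pow_le_card_divSocle h hf, exists_injective_of_two_pow_le h⟩

/-- A decreasing chain of subgroups of a finite group is eventually equal to its intersection. -/
lemma exists_forall_mem_divSocle (h : {x : A | 2 • x = 0}.Finite) :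
    ∃ k₀, ∀ k ≥ k₀, ∀ x, x ∈ divSocle A k ↔ ∀ l, x ∈ divSocle A l := by
  have : ∀ x : A, ∃ k₀, x ∈ divSocle A k₀ → ∀ l, x ∈ divSocle A l := by
    intro x
    by_cases hx : ∀ l, x ∈ divSocle A l
    · exact ⟨0, fun _ => hx⟩
    · push Not at hx
      exact ⟨hx.choose, fun t => absurd t hx.choose_spec⟩
  choose K hK using this
  refine ⟨h.toFinset.sup K, fun k hk x => ⟨fun hx => hK x ?_, fun hx => hx k⟩⟩
  refine divSocle_antitone (le_trans ?_ hk) hx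
  exact Finset.le_sup (f := K) (h.mem_toFinset.2 hx.1)

end AddSubgroup

/-! ### Divisible elements and their two-torsion -/

namespace AddSubgroup

variable {B C : Type*} [AddCommGroup B] [AddCommGroup C]

/-- An odd integer acts as the identity on elements killed by `2`, so for these divisibility by
powers of `2` already gives divisibility by every positive integer. -/
lemma mem_divSocle_forall_iff {A : AddSubgroup B} (x : A) :
    (∀ l, x ∈ divSocle A l) ↔ x.1 ∈ A.divisibleElements ∧ 2 • x.1 = 0 := by
  constructor
  · intro h
    have h2 : 2 • x.1 = 0 := congrArg Subtype.val (h 0).1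
    refine ⟨⟨x.2, fun n hn => ?_⟩, h2⟩
    obtain ⟨k, m, hm, rfl⟩ := Nat.exists_eq_two_pow_mul_odd hn.ne'
    obtain ⟨-, z, hz⟩ := h k
    refine ⟨z, z.2, ?_⟩
    have hz' : 2 ^ k • z.1 = x.1 := congrArg Subtype.val hz
    obtain ⟨c, rfl⟩ := hm
    rw [mul_comm, mul_smul, hz', add_smul, mul_comm, mul_smul, h2, smul_zero, zero_add, one_smul]
  · rintro ⟨⟨_, h⟩, h2⟩ l
    obtain ⟨y, hy, e⟩ := h (2 ^ l) (by positivity)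
    exact ⟨Subtype.ext h2, ⟨y, hy⟩, Subtype.ext e⟩

/-- With finite `2`-torsion, the divisible elements form a `2`-divisible group. -/
lemma exists_two_nsmul_eq_of_mem_divisibleElements {A : AddSubgroup B}
    (h : {x : B | x ∈ A ∧ 2 • x = 0}.Finite) {x : B} (hx : x ∈ A.divisibleElements) :
    ∃ y ∈ A.divisibleElements, 2 • y = x := by
  obtain ⟨y₀, hy₀, e₀⟩ := hx.2 2 two_pos
  have hfin : {y : B | y ∈ A ∧ 2 • y = x}.Finite := by
    refine (h.image (fun t => t + y₀)).subset ?_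
    rintro y ⟨hy, e⟩
    exact ⟨y - y₀, ⟨A.sub_mem hy hy₀, by rw [smul_sub, e, e₀, sub_self]⟩, sub_add_cancel _ _⟩
  by_contra! hcon
  have : ∀ y : B, ∃ n : ℕ, 0 < n ∧ (y ∈ A → 2 • y = x → ∀ z ∈ A, n • z ≠ y) := by
    intro y
    by_cases hy : y ∈ A ∧ 2 • y = x
    · have h1 : y ∉ A.divisibleElements := fun t => hcon y t hy.2
      have h2 : ¬ ∀ n : ℕ, 0 < n → ∃ z ∈ A, n • z = y := fun t => h1 ⟨hy.1, t⟩
      push Not at h2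
      obtain ⟨n, hn, h2⟩ := h2
      exact ⟨n, hn, fun _ _ => h2⟩
    · exact ⟨1, one_pos, fun a b => absurd ⟨a, b⟩ hy⟩
  choose N hN hN' using this
  -- Each of the finitely many halves `y` of `x` fails to be divisible by `N y`. Dividing `x` by
  -- twice the product of all the `N y` produces a half that is divisible by its own `N y`, a
  -- contradiction.
  set n := ∏ y ∈ hfin.toFinset, N y with hn
  have hn0 : 0 < n := Finset.prod_pos fun y _ => hN y
  obtain ⟨z, hz, e⟩ := hx.2 (2 * n) (by positivity)
  have hmem : n • z ∈ A := A.nsmul_mem hz n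
  have e' : 2 • (n • z) = x := by rw [smul_smul, e]
  obtain ⟨c, hc⟩ : N (n • z) ∣ n := Finset.dvd_prod_of_mem N (hfin.mem_toFinset.2 ⟨hmem, e'⟩)
  refine hN' _ hmem e' (c • z) (A.nsmul_mem hz c) ?_
  rw [smul_smul, ← hc]

/-- The elements of `A` killed by `2`. -/
def twoTorsion (A : AddSubgroup B) : AddSubgroup B := A ⊓ (nsmulAddMonoidHom 2 : B →+ B).ker

lemma map_mem_divisibleElements {A : AddSubgroup B} {A' : AddSubgroup C} {ψ : B →+ C}
    (hψ : ∀ x ∈ A, ψ x ∈ A') {x : B} (hx : x ∈ A.divisibleElements) :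
    ψ x ∈ A'.divisibleElements := by
  refine ⟨hψ _ hx.1, fun n hn => ?_⟩
  obtain ⟨y, hy, rfl⟩ := hx.2 n hn
  exact ⟨ψ y, hψ _ hy, (map_nsmul _ _ _).symm⟩

/-- If `ψ` and `ψ'` compose to multiplication by `2`, the order of the `2`-torsion of the divisible
part is the product of the orders of the two kernels. -/
lemma card_twoTorsion_divisibleElements {A : AddSubgroup B} {A' : AddSubgroup C} {ψ : B →+ C}
    {ψ' : C →+ B} (hψ : ∀ x ∈ A, ψ x ∈ A') (hψ' : ∀ x ∈ A', ψ' x ∈ A)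
    (h : ∀ x, ψ' (ψ x) = 2 • x) (h' : ∀ x, ψ (ψ' x) = 2 • x)
    (hfin : {x : C | x ∈ A' ∧ 2 • x = 0}.Finite) :
    Nat.card A.divisibleElements.twoTorsion =
      Nat.card ↥(ψ.ker ⊓ A.divisibleElements) * Nat.card ↥(ψ'.ker ⊓ A'.divisibleElements) := by
  let f : A.divisibleElements.twoTorsion →+ ↥(ψ'.ker ⊓ A'.divisibleElements) :=
    (ψ.comp (AddSubgroup.subtype _)).codRestrict _ (by
      rintro ⟨x, hx, hx2⟩
      exact ⟨(h x).trans hx2, map_mem_divisibleElements hψ hx⟩)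
  -- Halving `b` inside the divisible part as `2 • c`, the preimage is `ψ' c`; it is killed by `2`
  -- because `ψ' b = 0`.
  have hf : Function.Surjective f := by
    rintro ⟨b, hb, hb'⟩
    obtain ⟨c, hc, rfl⟩ := exists_two_nsmul_eq_of_mem_divisibleElements hfin hb'
    refine ⟨⟨ψ' c, map_mem_divisibleElements hψ' hc, ?_⟩, Subtype.ext (h' c)⟩
    exact (map_nsmul ψ' 2 c).symm.trans hb
  have hker : Nat.card f.ker = Nat.card ↥(ψ.ker ⊓ A.divisibleElements) := by
    refine Nat.card_congr ⟨fun x => ⟨x.1.1, congrArg Subtype.val x.2, x.1.2.1⟩,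
      fun x => ⟨⟨x.1, x.2.2, ?_⟩, Subtype.ext x.2.1⟩, fun _ => rfl, fun _ => rfl⟩
    change 2 • x.1 = 0
    rw [← h, show ψ x.1 = 0 from x.2.1, map_zero]
  rw [AddSubgroup.card_eq_card_quotient_mul_card_addSubgroup f.ker, hker, mul_comm,
    Nat.card_congr (QuotientAddGroup.quotientKerEquivOfSurjective f hf).toEquiv]

end AddSubgroup

/-! ### Two-torsion and halving of points -/

namespace WeierstrassCurve

section TwoDivision

variable {F : Type*} [Field F] [IsAlgClosed F] [CharZero F]

lemma exists_roots_cubic (a b c : F) : ∃ e₁ e₂ e₃ : F,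
    a = -(e₁ + e₂ + e₃) ∧ b = e₁ * e₂ + e₁ * e₃ + e₂ * e₃ ∧ c = -(e₁ * e₂ * e₃) := by
  obtain ⟨e, he⟩ : ∃ e : F, e ^ 3 + a * e ^ 2 + b * e + c = 0 := by
    have hdeg : (Polynomial.X ^ 3 + Polynomial.C a * Polynomial.X ^ 2 +
        Polynomial.C b * Polynomial.X + Polynomial.C c : Polynomial F).degree = 3 := by
      compute_degree!
    obtain ⟨e, he⟩ := IsAlgClosed.exists_root _ (hdeg.trans_ne (by decide))
    exact ⟨e, by simpa using he⟩
  -- A square root of the discriminant of the quadratic left after dividing out `X - e`.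
  obtain ⟨s, hs⟩ := IsAlgClosed.exists_pow_nat_eq ((a + e) ^ 2 - 4 * (b + e * (a + e))) two_pos
  refine ⟨e, (-(a + e) + s) / 2, (-(a + e) - s) / 2, by ring, by linear_combination hs / 4, ?_⟩
  linear_combination he - e * hs / 4

variable {W : Affine F} [DecidableEq F] (h₁ : W.a₁ = 0) (h₃ : W.a₃ = 0)
include h₁ h₃

/-- The classical halving formula: with `x₀ - eᵢ = rᵢ²` and the signs chosen so that `r₁ r₂ r₃ =
y₀`, a half has coordinates `x₀ + r₁r₂ + r₁r₃ + r₂r₃` and `(r₁+r₂)(r₁+r₃)(r₂+r₃)`, with tangent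
slope `r₁ + r₂ + r₃`. The sums `rᵢ + rⱼ` are nonzero because the roots `eᵢ` are distinct. -/
lemma exists_two_nsmul_eq [W.IsElliptic] (P : W.Point) : ∃ Q : W.Point, 2 • Q = P := by
  rcases P with _ | ⟨x₀, y₀, h⟩
  · exact ⟨0, smul_zero _⟩
  obtain ⟨e₁, e₂, e₃, h₂, h₄, h₆⟩ := exists_roots_cubic W.a₂ W.a₄ W.a₆
  have heq := h.1
  have hΔ : W.Δ ≠ 0 := W.isUnit_Δ.ne_zero
  simp only [Δ, b₂, b₄, b₆, b₈, h₁, h₃, h₂, h₄, h₆] at hΔ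
  rw [Affine.equation_iff, h₁, h₃, h₂, h₄, h₆] at heq
  obtain ⟨r₁, hr₁⟩ := IsAlgClosed.exists_pow_nat_eq (x₀ - e₁) two_pos
  obtain ⟨r₂, hr₂⟩ := IsAlgClosed.exists_pow_nat_eq (x₀ - e₂) two_pos
  obtain ⟨r₃, hr₃, hr⟩ : ∃ r₃, r₃ ^ 2 = x₀ - e₃ ∧ r₁ * r₂ * r₃ = y₀ := by
    obtain ⟨r, hr⟩ := IsAlgClosed.exists_pow_nat_eq (x₀ - e₃) two_pos
    have : (r₁ * r₂ * r) ^ 2 = y₀ ^ 2 := by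
      rw [mul_pow, mul_pow, hr₁, hr₂, hr]
      linear_combination -heq
    rcases sq_eq_sq_iff_eq_or_eq_neg.1 this with t | t
    · exact ⟨r, hr, t⟩
    · exact ⟨-r, by rw [neg_sq, hr], by rw [mul_neg, t, neg_neg]⟩
  obtain rfl : e₁ = x₀ - r₁ ^ 2 := by rw [hr₁]; ring
  obtain rfl : e₂ = x₀ - r₂ ^ 2 := by rw [hr₂]; ring
  obtain rfl : e₃ = x₀ - r₃ ^ 2 := by rw [hr₃]; ring
  subst hr
  have n₁ : r₁ + r₂ ≠ 0 := fun t => hΔ (by rw [eq_neg_of_add_eq_zero_left t]; ring)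
  have n₂ : r₁ + r₃ ≠ 0 := fun t => hΔ (by rw [eq_neg_of_add_eq_zero_left t]; ring)
  have n₃ : r₂ + r₃ ≠ 0 := fun t => hΔ (by rw [eq_neg_of_add_eq_zero_left t]; ring)
  set x := x₀ + r₁ * r₂ + r₁ * r₃ + r₂ * r₃ with hx
  set y := (r₁ + r₂) * (r₁ + r₃) * (r₂ + r₃) with hy
  have hy0 : y ≠ 0 := mul_ne_zero (mul_ne_zero n₁ n₂) n₃
  have hns : W.Nonsingular x y := by
    rw [← Affine.equation_iff_nonsingular, Affine.equation_iff, h₁, h₃, h₂, h₄, h₆]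
    ring
  have hny : W.negY x y = -y := by simp [Affine.negY, h₁, h₃]
  have hyn : y ≠ W.negY x y := by
    rw [hny]
    exact fun t => hy0 (self_eq_neg.1 t)
  have hslope : W.slope x x y y = r₁ + r₂ + r₃ := by
    rw [Affine.slope_of_Y_ne rfl hyn, hny, div_eq_iff (by rw [sub_neg_eq_add, ← two_mul]; simpa),
      h₁, h₂, h₄]
    ring
  refine ⟨.some x y hns, ?_⟩
  rw [two_nsmul, Affine.Point.add_some (fun t => hyn t.2)]
  simp only [Affine.Point.some.injEq]
  rw [hslope]
  simp only [Affine.addX, Affine.addY, Affine.negAddY, Affine.negY, h₁, h₃, h₂]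
  exact ⟨by ring, by ring⟩

omit [IsAlgClosed F] in
lemma Y_eq_zero_of_two_nsmul {x y : F} {h : W.Nonsingular x y}
    (h2 : 2 • Affine.Point.some x y h = 0) : y = 0 := by
  rw [two_nsmul, ← eq_neg_iff_add_eq_zero, Affine.Point.neg_some] at h2
  have := ((Affine.Point.some.injEq ..).mp h2).2
  rw [Affine.negY, h₁, h₃, zero_mul, sub_zero, sub_zero] at this
  exact self_eq_neg.1 this

lemma finite_two_torsion_and_ncard_le :
    {P : W.Point | 2 • P = 0}.Finite ∧ {P : W.Point | 2 • P = 0}.ncard ≤ 4 := by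
  obtain ⟨e₁, e₂, e₃, h₂, h₄, h₆⟩ := exists_roots_cubic W.a₂ W.a₄ W.a₆
  classical
  let g : F → W.Point := fun x => if h : W.Nonsingular x 0 then .some x 0 h else 0
  have hsub : {P : W.Point | 2 • P = 0} ⊆
      (↑({0, g e₁, g e₂, g e₃} : Finset W.Point) : Set W.Point) := by
    rintro (_ | ⟨x, y, h⟩) hP
    · simp [← Affine.Point.zero_def]
    · obtain rfl := Y_eq_zero_of_two_nsmul h₁ h₃ hP
      have hg : g x = .some x 0 h := dif_pos h
      rw [← hg]
      have heq := h.1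
      rw [Affine.equation_iff, h₁, h₃, h₂, h₄, h₆] at heq
      have : (x - e₁) * (x - e₂) * (x - e₃) = 0 := by linear_combination -heq
      rcases mul_eq_zero.1 this with t | t
      · rcases mul_eq_zero.1 t with t | t
        · simp [sub_eq_zero.1 t]
        · simp [sub_eq_zero.1 t]
      · simp [sub_eq_zero.1 t]
  refine ⟨(Finset.finite_toSet _).subset hsub, ?_⟩
  refine (Set.ncard_le_ncard hsub (Finset.finite_toSet _)).trans ?_
  rw [Set.ncard_coe_finset]
  exact Finset.card_le_four

end TwoDivision

end WeierstrassCurve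

/-! ### Quadratic characters of absolute Galois groups -/

lemma Nat.isSquare_of_even_factorization {n : ℕ} (hn : n ≠ 0)
    (h : ∀ p, p.Prime → Even (n.factorization p)) : IsSquare n := by
  rw [← Nat.prod_factorization_pow_eq_self hn, Finsupp.prod, isSquare_iff_exists_sq]
  refine ⟨∏ p ∈ n.factorization.support, p ^ (n.factorization p / 2), ?_⟩
  rw [← Finset.prod_pow]
  refine Finset.prod_congr rfl fun p hp => ?_
  rw [← pow_mul, Nat.div_mul_cancel (h p (Nat.prime_of_mem_primeFactors
    (Nat.support_factorization n ▸ hp))).two_dvd]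

/-- Multiplying by the square of the denominator reduces to the natural number `num * den`. -/
lemma Rat.isSquare_of_even_padicValRat {q : ℚ} (hq : 0 < q)
    (h : ∀ p, p.Prime → Even (padicValRat p q)) : IsSquare q := by
  have hd : (q.den : ℚ) ≠ 0 := by exact_mod_cast q.den_ne_zero
  have hnum : 0 < q.num := Rat.num_pos.2 hq
  have hn0 : q.num.natAbs * q.den ≠ 0 := mul_ne_zero (by lia) q.den_ne_zero
  have hqe : ((q.num.natAbs * q.den : ℕ) : ℚ) = q * q.den ^ 2 := by
    have : ((q.num.natAbs : ℕ) : ℚ) = q.num := by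
      rw [← Int.cast_natCast, Int.natAbs_of_nonneg hnum.le]
    rw [Nat.cast_mul, this, ← Rat.mul_den_eq_num]
    ring
  have hsq : IsSquare (q.num.natAbs * q.den) := by
    refine Nat.isSquare_of_even_factorization hn0 fun p hp => ?_
    have : Fact p.Prime := ⟨hp⟩
    rw [Nat.factorization_def _ hp, ← Int.even_coe_nat, ← padicValRat.of_nat, hqe,
      padicValRat.mul hq.ne' (pow_ne_zero _ hd), padicValRat.pow]
    exact (h p hp).add (even_two_mul _)
  obtain ⟨r, hr⟩ := hsq
  refine ⟨r / q.den, ?_⟩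
  rw [hr] at hqe
  field_simp
  rw [← hqe]
  push_cast
  ring

section Kummer

variable {K : Type} [Field K] [CharZero K]

/-- An open subgroup of index at most `2` of an absolute Galois group is cut out by a square
root. -/
lemma AbsGal.exists_sqrt_of_isOpen (N : Subgroup (AbsGal K)) (hN : IsOpen (N : Set (AbsGal K)))
    (h2 : ∀ σ τ, σ ∉ N → τ ∉ N → σ * τ ∈ N) :
    ∃ (m : K) (s : AlgebraicClosure K), m ≠ 0 ∧ s ^ 2 = algebraMap K _ m ∧
      ∀ σ : AbsGal K, σ ∈ N ↔ σ s = s := by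
  by_cases htop : N = ⊤
  · exact ⟨1, 1, one_ne_zero, by simp, by simp [htop]⟩
  obtain ⟨τ, hτ⟩ : ∃ τ, τ ∉ N := by
    by_contra! t
    exact htop (eq_top_iff.2 fun σ _ => t σ)
  have hfix := InfiniteGalois.fixingSubgroup_fixedField
    (⟨N, Subgroup.isClosed_of_isOpen N hN⟩ : ClosedSubgroup (AbsGal K))
  change (IntermediateField.fixedField N).fixingSubgroup = N at hfix
  have hfix' : ∀ σ : AbsGal K, (∀ x, (∀ ρ ∈ N, ρ x = x) → σ x = x) → σ ∈ N := by
    intro σ hσ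
    rw [← hfix, IntermediateField.mem_fixingSubgroup_iff]
    exact fun x hx => hσ x fun ρ hρ => (IntermediateField.mem_fixedField_iff _ _).1 hx ρ hρ
  -- By the Galois correspondence `τ` moves some `x` fixed by `N`. Every element outside `N`
  -- exchanges `x` and `τ x`, so `x - τ x` is fixed by `N` and negated off `N`; its square is the
  -- desired `m`.
  obtain ⟨x, hx, hτx⟩ : ∃ x, (∀ ρ ∈ N, ρ x = x) ∧ τ x ≠ x := by
    by_contra! t
    exact hτ (hfix' τ t)
  have hinv : τ⁻¹ ∉ N := fun t => hτ (by simpa using N.inv_mem t)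
  have hin : ∀ ρ ∈ N, ρ (τ x) = τ x := by
    intro ρ hρ
    have hρτ : ρ * τ ∉ N := fun t => hτ ((N.mul_mem_cancel_left hρ).1 t)
    have := hx _ (h2 _ _ hinv hρτ)
    rw [AlgEquiv.mul_apply, AlgEquiv.mul_apply] at this
    have h3 := congrArg τ this
    rwa [← AlgEquiv.mul_apply, mul_inv_cancel, AlgEquiv.one_apply] at h3
  have hout : ∀ ρ ∉ N, ρ x = τ x ∧ ρ (τ x) = x := by
    intro ρ hρ
    refine ⟨?_, hx _ (h2 _ _ hρ hτ)⟩
    have := congrArg τ (hx _ (h2 _ _ hinv hρ))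
    rwa [AlgEquiv.mul_apply, ← AlgEquiv.mul_apply, mul_inv_cancel, AlgEquiv.one_apply] at this
  have hs0 : x - τ x ≠ 0 := sub_ne_zero.2 (Ne.symm hτx)
  have hpos : ∀ ρ ∈ N, ρ (x - τ x) = x - τ x := fun ρ hρ => by
    rw [map_sub, hx ρ hρ, hin ρ hρ]
  have hneg : ∀ ρ ∉ N, ρ (x - τ x) = -(x - τ x) := fun ρ hρ => by
    rw [map_sub, (hout ρ hρ).1, (hout ρ hρ).2, neg_sub]
  obtain ⟨m, hm⟩ : ∃ m, algebraMap K _ m = (x - τ x) ^ 2 := by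
    refine (InfiniteGalois.mem_range_algebraMap_iff_fixed (k := K) _).2 fun ρ => ?_
    rw [map_pow]
    by_cases hρ : ρ ∈ N
    · rw [hpos ρ hρ]
    · rw [hneg ρ hρ, neg_sq]
  refine ⟨m, x - τ x, ?_, hm.symm, fun σ => ⟨hpos σ, fun t => ?_⟩⟩
  · rintro rfl
    rw [map_zero] at hm
    exact pow_ne_zero 2 hs0 hm.symm
  · by_contra hσ
    rw [hneg σ hσ] at t
    exact hs0 (neg_eq_self.1 t)

end Kummer

/-- There are finitely many quadratic characters of `Gal(ℚ̄/ℚ)` cut out by square roots of rational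
numbers with even valuation away from a given finite set of primes. -/
lemma AbsGal.finite_quadratic (S : Finset ℕ) :
    {N : Subgroup (AbsGal ℚ) | ∃ (m : ℚ) (s : AlgebraicClosure ℚ), m ≠ 0 ∧
      s ^ 2 = (m : AlgebraicClosure ℚ) ∧ (∀ σ : AbsGal ℚ, σ ∈ N ↔ σ s = s) ∧
      ∀ p, p.Prime → p ∉ S → Even (padicValRat p m)}.Finite := by
  rw [← Set.finite_coe_iff]
  choose m s hm hs hN hp using fun N : {N : Subgroup (AbsGal ℚ) |
    ∃ (m : ℚ) (s : AlgebraicClosure ℚ), m ≠ 0 ∧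
      s ^ 2 = (m : AlgebraicClosure ℚ) ∧ (∀ σ : AbsGal ℚ, σ ∈ N ↔ σ s = s) ∧
      ∀ p, p.Prime → p ∉ S → Even (padicValRat p m)} => N.2
  -- The sign of `m` and the parities of its valuations at `S` determine its square class, hence the
  -- subgroup.
  refine Finite.of_injective (β := Prop × (S → Prop))
    (fun N => (0 < m N, fun p => Even (padicValRat p (m N)))) ?_
  intro N N' h
  obtain ⟨h1, h2⟩ := Prod.mk.injEq .. ▸ h
  have hpos : 0 < m N * m N' := by
    rcases (hm N).lt_or_gt with t | t
    · have : ¬ 0 < m N' := h1 ▸ not_lt.2 t.le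
      exact mul_pos_of_neg_of_neg t ((not_lt.1 this).lt_of_ne (hm N'))
    · have : 0 < m N' := h1 ▸ t
      exact mul_pos t this
  obtain ⟨r, hr⟩ : IsSquare (m N * m N') := by
    refine Rat.isSquare_of_even_padicValRat hpos fun p hpp => ?_
    have : Fact p.Prime := ⟨hpp⟩
    rw [padicValRat.mul (hm N) (hm N')]
    by_cases hpS : p ∈ S
    · rw [Int.even_add]
      exact Iff.of_eq (congrFun h2 ⟨p, hpS⟩)
    · exact (hp N p hpp hpS).add (hp N' p hpp hpS)
  have hr0 : r ≠ 0 := by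
    rintro rfl
    simp [hpos.ne'] at hr
  -- The product of the two square roots is rational, so an automorphism fixes one exactly when it
  -- fixes the other.
  have hss : ∃ c : ℚ, c ≠ 0 ∧ s N * s N' = (c : AlgebraicClosure ℚ) := by
    have : (s N * s N') ^ 2 = (r : AlgebraicClosure ℚ) ^ 2 := by
      rw [mul_pow, hs, hs, ← Rat.cast_mul, hr, ← pow_two, Rat.cast_pow]
    rcases sq_eq_sq_iff_eq_or_eq_neg.1 this with t | t
    · exact ⟨r, hr0, t⟩
    · exact ⟨-r, neg_ne_zero.2 hr0, by rw [t, Rat.cast_neg]⟩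
  obtain ⟨c, hc, hss⟩ := hss
  have hc' : s N * s N' ≠ 0 := by rw [hss]; exact_mod_cast hc
  refine Subtype.ext (Subgroup.ext fun σ => ?_)
  rw [hN, hN]
  have hσ : σ (s N) * σ (s N') = s N * s N' := by rw [← map_mul, hss, map_ratCast]
  constructor
  · intro t
    rw [t] at hσ
    exact mul_left_cancel₀ (left_ne_zero_of_mul hc') hσ
  · intro t
    rw [t] at hσ
    exact mul_right_cancel₀ (right_ne_zero_of_mul hc') hσ

section

open scoped Classical

/-! ### Local conditions for descent by a rational point of order two -/

lemma Padic.valuation_eq_of_norm_eq {p : ℕ} [Fact p.Prime] {x y : ℚ_[p]} (hx : x ≠ 0)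
    (h : ‖x‖ = ‖y‖) : x.valuation = y.valuation := by
  have hy : y ≠ 0 := by rwa [← norm_ne_zero_iff, ← h, norm_ne_zero_iff]
  rw [Padic.norm_eq_zpow_neg_valuation hx, Padic.norm_eq_zpow_neg_valuation hy] at h
  have hp : (1 : ℝ) < p := by exact_mod_cast (Fact.out : p.Prime).one_lt
  exact neg_injective (zpow_right_injective₀ (by linarith) hp.ne' h)

/-- The quadratic factor has the norm of a square: it is a unit when `‖X‖ < 1`, and has norm `‖X‖ ^
2` when `‖X‖ > 1`. So the valuation of `X` is even; when `‖X‖ = 1` there is nothing to do. -/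
lemma Padic.even_valuation_of_sq_eq {p : ℕ} [Fact p.Prime] {X y a D : ℚ_[p]} (hX : X ≠ 0)
    (ha : ‖a‖ ≤ 1) (hD : ‖D‖ = 1) (h : y ^ 2 = X * (X ^ 2 - 2 * a * X + D)) :
    Even X.valuation := by
  have h2a : ‖-(2 * a)‖ ≤ 1 := by
    rw [norm_neg, norm_mul]
    exact mul_le_one₀ (by simpa using Padic.norm_int_le_one (p := p) 2) (norm_nonneg _) ha
  have key : ∀ c : ℚ_[p], c ≠ 0 → ‖X ^ 2 - 2 * a * X + D‖ = ‖c ^ 2‖ → Even X.valuation := by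
    intro c hc hn
    have hq : X ^ 2 - 2 * a * X + D ≠ 0 := by
      rw [← norm_ne_zero_iff, hn, norm_ne_zero_iff]
      exact pow_ne_zero 2 hc
    have hv := congrArg Padic.valuation h
    rw [Padic.valuation_mul hX hq, Padic.valuation_eq_of_norm_eq hq hn, Padic.valuation_pow,
      Padic.valuation_pow] at hv
    exact ⟨y.valuation - c.valuation, by push_cast at hv; linarith⟩
  rcases lt_trichotomy ‖X‖ 1 with hlt | heq | hgt
  · refine key 1 one_ne_zero ?_
    have h1 : ‖X * (X + -(2 * a))‖ < 1 := by
      rw [norm_mul]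
      exact mul_lt_one_of_nonneg_of_lt_one_left (norm_nonneg _) hlt
        ((Padic.nonarchimedean _ _).trans (max_le hlt.le h2a))
    have hne : ‖X * (X + -(2 * a))‖ ≠ ‖D‖ := by rw [hD]; exact h1.ne
    rw [show X ^ 2 - 2 * a * X + D = X * (X + -(2 * a)) + D by ring,
      Padic.add_eq_max_of_ne hne, hD, max_eq_right h1.le, one_pow, norm_one]
  · rw [Padic.valuation_eq_of_norm_eq hX (heq.trans norm_one.symm), Padic.valuation_one]
    exact Even.zero
  · refine key X hX ?_
    have h1 : ‖-(2 * a) * X + D‖ < ‖X ^ 2‖ := by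
      refine (Padic.nonarchimedean _ _).trans_lt (max_lt ?_ ?_)
      · rw [norm_mul, pow_two, norm_mul]
        refine mul_lt_mul_of_pos_right (h2a.trans_lt hgt) (one_pos.trans hgt)
      · rw [hD, norm_pow]
        exact one_lt_pow₀ hgt two_ne_zero
    rw [show X ^ 2 - 2 * a * X + D = X ^ 2 + (-(2 * a) * X + D) by ring,
      Padic.add_eq_max_of_ne h1.ne', max_eq_left h1.le]

section Descent

variable {F L : Type*} [Field F] [Field L] [Algebra F L] [IsGalois F L]

/-- Descent for `y² = t (t² + a t + b)` along translation by `(0, 0)`. -/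
lemma exists_sq_eq_of_translation {a b m : F} {t y s : L} (ht : t ≠ 0) (hb : b ≠ 0)
    (hD : a ^ 2 - 4 * b ≠ 0)
    (h : y ^ 2 = t * (t ^ 2 + algebraMap F L a * t + algebraMap F L b))
    (hs : s ^ 2 = algebraMap F L m)
    (hσ : ∀ σ : L ≃ₐ[F] L, (σ s = s ∧ σ t = t ∧ σ y = y) ∨
      (σ s = -s ∧ σ t * t = algebraMap F L b ∧ σ y * t ^ 2 = -(y * algebraMap F L b))) :
    ∃ X z : F, X ≠ 0 ∧ z ^ 2 = m * X ∧
      (X = a ^ 2 - 4 * b ∨ ∃ w, w ^ 2 = X * (X ^ 2 - 2 * a * X + (a ^ 2 - 4 * b))) := by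
  have hinj := (algebraMap F L).injective
  have hb' : algebraMap F L b ≠ 0 := by simpa using hb
  have desc : ∀ x : L, (∀ σ : L ≃ₐ[F] L, σ x = x) → ∃ c, algebraMap F L c = x := fun x hx =>
    (InfiniteGalois.mem_range_algebraMap_iff_fixed x).2 hx
  have hσ' : ∀ σ : L ≃ₐ[F] L, (σ s = s ∧ σ t = t ∧ σ y = y) ∨
      (σ s = -s ∧ σ t = algebraMap F L b / t ∧ σ y = -(y * algebraMap F L b) / t ^ 2) := by
    intro σ
    refine (hσ σ).imp_right fun ⟨h1, h2, h3⟩ => ⟨h1, ?_, ?_⟩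
    · rw [← h2]; field_simp
    · rw [← h3]; field_simp
  -- Here `(t, 0)` is a point of order two other than `(0, 0)`. Translation exchanges `t` with the
  -- other root `b / t`, so `t - b / t` changes sign together with `s`, and its square is `a ^ 2 - 4
  -- * b`.
  by_cases hy : y = 0
  · subst hy
    have hq : t ^ 2 + algebraMap F L a * t + algebraMap F L b = 0 := by
      rw [zero_pow two_ne_zero] at h
      exact (mul_eq_zero.1 h.symm).resolve_left ht
    obtain ⟨z, hz⟩ := desc (s * (t - algebraMap F L b / t)) (by
      intro σ
      rcases hσ' σ with ⟨h1, h2, -⟩ | ⟨h1, h2, -⟩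
      · rw [map_mul, map_sub, map_div₀, h1, h2, AlgEquiv.commutes]
      · rw [map_mul, map_sub, map_div₀, h1, h2, AlgEquiv.commutes]
        field_simp
        ring)
    refine ⟨a ^ 2 - 4 * b, z, hD, hinj ?_, Or.inl rfl⟩
    have hw : t - algebraMap F L b / t = 2 * t + algebraMap F L a := by
      field_simp
      linear_combination -hq
    simp only [map_pow, map_mul, map_sub, hz, ← hs, map_ofNat, hw]
    linear_combination 4 * s ^ 2 * hq
  -- Translation negates `y / t`, so `z = s * (y / t)` descends, and so do `X = (y / t) ^ 2` and `w
  -- = (y / t) * (t - b / t)`, the coordinates of the image under the quotient by `(0, 0)`.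
  · obtain ⟨z, hz⟩ := desc (s * (y / t)) (by
      intro σ
      rcases hσ' σ with ⟨h1, h2, h3⟩ | ⟨h1, h2, h3⟩
      · rw [map_mul, map_div₀, h1, h2, h3]
      · rw [map_mul, map_div₀, h1, h2, h3]
        field_simp)
    obtain ⟨X, hX⟩ := desc ((y / t) ^ 2) (by
      intro σ
      rcases hσ' σ with ⟨h1, h2, h3⟩ | ⟨h1, h2, h3⟩
      · rw [map_pow, map_div₀, h2, h3]
      · rw [map_pow, map_div₀, h2, h3]
        field_simp)
    obtain ⟨w, hw⟩ := desc (y / t * (t - algebraMap F L b / t)) (by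
      intro σ
      rcases hσ' σ with ⟨h1, h2, h3⟩ | ⟨h1, h2, h3⟩
      · rw [map_mul, map_div₀, map_sub, map_div₀, h2, h3, AlgEquiv.commutes]
      · rw [map_mul, map_div₀, map_sub, map_div₀, h2, h3, AlgEquiv.commutes]
        field_simp
        ring)
    have hXt : algebraMap F L X = t + algebraMap F L b / t + algebraMap F L a := by
      rw [hX, div_pow, h]
      field_simp
      ring
    refine ⟨X, z, ?_, hinj ?_, Or.inr ⟨w, hinj ?_⟩⟩
    · rintro rfl
      rw [map_zero] at hX
      exact pow_ne_zero 2 (div_ne_zero hy ht) hX.symm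
    · rw [map_pow, map_mul, hz, hX, ← hs]
      ring
    · simp only [map_pow, map_mul, map_sub, map_add, hw, map_ofNat]
      rw [mul_pow, ← hX, hXt]
      field_simp
      ring

end Descent

namespace WeierstrassCurve

section Translation

variable {F : Type*} [Field F] {W : Affine F} (h₁ : W.a₁ = 0) (h₃ : W.a₃ = 0)
include h₁ h₃

/-- The coordinates of the translate of `(x, y)` by the point `(e, 0)` of order two. -/
lemma add_two_torsion {x y x' y' e : F} {h : W.Nonsingular x y} {h' : W.Nonsingular x' y'}
    {hT : W.Nonsingular e 0} (hx : x ≠ e)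
    (hadd : Affine.Point.some x' y' h' = Affine.Point.some x y h + Affine.Point.some e 0 hT) :
    (x' - e) * (x - e) = 3 * e ^ 2 + 2 * W.a₂ * e + W.a₄ ∧
      y' * (x - e) ^ 2 = -(y * (3 * e ^ 2 + 2 * W.a₂ * e + W.a₄)) := by
  rw [Affine.Point.add_some (fun t => hx t.1)] at hadd
  obtain ⟨rfl, rfl⟩ := (Affine.Point.some.injEq ..).mp hadd
  rw [Affine.slope_of_X_ne hx]
  have heq := h.1
  have heT := hT.1
  rw [Affine.equation_iff, h₁, h₃] at heq heT
  have hx0 : x - e ≠ 0 := sub_ne_zero.2 hx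
  simp only [Affine.addX, Affine.addY, Affine.negAddY, Affine.negY, h₁, h₃]
  constructor
  · field_simp
    linear_combination heq - heT
  · field_simp
    linear_combination (-y) * heq + y * heT

end Translation

end WeierstrassCurve

namespace WeierstrassCurve

section

variable {K : Type} [Field K] {W : WeierstrassCurve K}

/-- The shift `x = t + e` turns the curve into `y² = t (t² + a t + b)` with `a = 3e + a₂` and `b =
3e² + 2a₂e + a₄`, of discriminant `16 b² (a² - 4b)`. -/
lemma Δ_eq_of_root (h₁ : W.a₁ = 0) (h₃ : W.a₃ = 0) {e : K}
    (he : e ^ 3 + W.a₂ * e ^ 2 + W.a₄ * e + W.a₆ = 0) :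
    W.Δ = 16 * (3 * e ^ 2 + 2 * W.a₂ * e + W.a₄) ^ 2 *
      ((3 * e + W.a₂) ^ 2 - 4 * (3 * e ^ 2 + 2 * W.a₂ * e + W.a₄)) := by
  obtain h₆ : W.a₆ = -(e ^ 3 + W.a₂ * e ^ 2 + W.a₄ * e) := by linear_combination he
  simp only [Δ, b₂, b₄, b₆, b₈, h₁, h₃, h₆]
  ring

lemma ne_zero_of_equation [W.IsElliptic] (h₁ : W.a₁ = 0) (h₃ : W.a₃ = 0) {L : Type} [Field L]
    [Algebra K L] {e : K} (h : (Affine.baseChange W.toAffine L).Equation (algebraMap K L e) 0) :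
    3 * e ^ 2 + 2 * W.a₂ * e + W.a₄ ≠ 0 ∧
      (3 * e + W.a₂) ^ 2 - 4 * (3 * e ^ 2 + 2 * W.a₂ * e + W.a₄) ≠ 0 := by
  rw [Affine.equation_iff] at h
  have he : e ^ 3 + W.a₂ * e ^ 2 + W.a₄ * e + W.a₆ = 0 := by
    apply (algebraMap K L).injective
    simp only [map_add, map_mul, map_pow, map_zero]
    simpa [eq_comm, h₁, h₃] using h
  have hΔ := W.isUnit_Δ.ne_zero
  rw [Δ_eq_of_root h₁ h₃ he] at hΔ
  exact ⟨pow_ne_zero_iff two_ne_zero |>.1 (right_ne_zero_of_mul (left_ne_zero_of_mul hΔ)),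
    right_ne_zero_of_mul hΔ⟩

variable {k L : Type} [Field k] [Field L] [Algebra K k] [Algebra K L] [Algebra k L]
  [IsScalarTower K k L]

lemma smul_some (σ : L ≃ₐ[k] L) {x y : L} (h : (Affine.baseChange W.toAffine L).Nonsingular x y) :
    ∃ h', σ • (Affine.Point.some x y h : W.Pts L) = Affine.Point.some (σ x) (σ y) h' := ⟨_, rfl⟩

/-- If translation by a rational point of order two describes the Galois orbit of a point `P`, then
the square class of the corresponding quadratic character is constrained. -/
lemma exists_sq_eq_of_smul_eq [IsGalois k L] [W.IsElliptic] (h₁ : W.a₁ = 0) (h₃ : W.a₃ = 0) {e : K}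
    (hT : (Affine.baseChange W.toAffine L).Nonsingular (algebraMap K L e) 0) (P : W.Pts L)
    {m : K} {s : L} (hs : s ^ 2 = algebraMap K L m)
    (hσ : ∀ σ : L ≃ₐ[k] L, (σ s = s ∧ σ • P = P) ∨
      (σ s = -s ∧ σ • P = P + (.some (algebraMap K L e) 0 hT : W.Pts L))) :
    ∃ X z : k, X ≠ 0 ∧ z ^ 2 = algebraMap K k m * X ∧
      (X = 1 ∨ X = algebraMap K k
        ((3 * e + W.a₂) ^ 2 - 4 * (3 * e ^ 2 + 2 * W.a₂ * e + W.a₄)) ∨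
      ∃ w, w ^ 2 = X * (X ^ 2 - 2 * algebraMap K k (3 * e + W.a₂) * X + algebraMap K k
        ((3 * e + W.a₂) ^ 2 - 4 * (3 * e ^ 2 + 2 * W.a₂ * e + W.a₄)))) := by
  have H₁ : (Affine.baseChange W.toAffine L).a₁ = 0 :=
    (congrArg (algebraMap K L) h₁).trans (map_zero _)
  have H₃ : (Affine.baseChange W.toAffine L).a₃ = 0 :=
    (congrArg (algebraMap K L) h₃).trans (map_zero _)
  have H₂ : (Affine.baseChange W.toAffine L).a₂ = algebraMap K L W.a₂ := rfl
  have H₄ : (Affine.baseChange W.toAffine L).a₄ = algebraMap K L W.a₄ := rfl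
  have H₆ : (Affine.baseChange W.toAffine L).a₆ = algebraMap K L W.a₆ := rfl
  have hTe := hT.1
  obtain ⟨hb, hD⟩ := ne_zero_of_equation h₁ h₃ hTe
  rw [Affine.equation_iff, H₁, H₃, H₂, H₄, H₆] at hTe
  have hinj := (algebraMap K k).injective
  -- If `P` is fixed, no automorphism can add the nonzero point of order two, so `s` is fixed and
  -- `m` is a square in `k`. This disposes of `P = 0` and of `P` equal to that point, where
  -- translation has no affine formula.
  have htriv : (∀ σ : L ≃ₐ[k] L, σ • P = P) → ∃ z : k, z ^ 2 = algebraMap K k m := by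
    intro hP
    obtain ⟨z, hz⟩ := (InfiniteGalois.mem_range_algebraMap_iff_fixed (k := k) s).2 fun σ => by
      rcases hσ σ with ⟨t, -⟩ | ⟨-, t⟩
      · exact t
      · rw [hP] at t
        exact absurd (left_eq_add.1 t) (by rintro ⟨⟩)
    refine ⟨z, (algebraMap k L).injective ?_⟩
    rw [map_pow, hz, hs, IsScalarTower.algebraMap_apply K k L]
  rcases P with _ | ⟨x, y, h⟩
  · obtain ⟨z, hz⟩ := htriv fun σ => rfl
    exact ⟨1, z, one_ne_zero, by rw [hz, mul_one], Or.inl rfl⟩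
  have hxy := h.1
  rw [Affine.equation_iff, H₁, H₃, H₂, H₄, H₆] at hxy
  by_cases hx : x = algebraMap K L e
  · subst hx
    have hy : y = 0 := by
      have : y ^ 2 = 0 := by linear_combination hxy - hTe
      exact pow_eq_zero_iff two_ne_zero |>.1 this
    subst hy
    obtain ⟨z, hz⟩ := htriv fun σ => by
      refine (Affine.Point.some.injEq ..).mpr ⟨?_, map_zero σ⟩
      change σ (algebraMap K L e) = algebraMap K L e
      rw [IsScalarTower.algebraMap_apply K k L, AlgEquiv.commutes]
    exact ⟨1, z, one_ne_zero, by rw [hz, mul_one], Or.inl rfl⟩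
  · have tower : ∀ c : K, algebraMap k L (algebraMap K k c) = algebraMap K L c := fun c =>
      (IsScalarTower.algebraMap_apply K k L c).symm
    obtain ⟨X, z, hX, hz, hXz⟩ := exists_sq_eq_of_translation (F := k)
      (a := algebraMap K k (3 * e + W.a₂)) (b := algebraMap K k (3 * e ^ 2 + 2 * W.a₂ * e + W.a₄))
      (m := algebraMap K k m) (t := x - algebraMap K L e) (y := y) (s := s) (sub_ne_zero.2 hx)
      ((map_ne_zero _).2 hb) (fun t => hD (hinj (by
        rw [map_zero, ← t]
        simp only [map_sub, map_mul, map_pow, map_ofNat])))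
      (by
        simp only [tower, map_add, map_mul, map_pow, map_ofNat]
        linear_combination hxy - hTe)
      (by rw [tower, hs]) (by
        intro σ
        have hσe : σ (x - algebraMap K L e) = σ x - algebraMap K L e := by
          rw [map_sub, ← tower, AlgEquiv.commutes]
        refine (hσ σ).imp ?_ ?_
        · rintro ⟨t, t'⟩
          obtain ⟨h', e'⟩ := smul_some σ h
          rw [e'] at t'
          obtain ⟨t₁, t₂⟩ := (Affine.Point.some.injEq ..).mp t'
          exact ⟨t, by rw [hσe, t₁], t₂⟩
        · rintro ⟨t, t'⟩
          obtain ⟨h', e'⟩ := smul_some σ h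
          rw [e'] at t'
          have := add_two_torsion H₁ H₃ hx t'
          refine ⟨t, ?_, ?_⟩
          · rw [hσe, this.1, H₂, H₄, tower]
            simp only [map_add, map_mul, map_pow, map_ofNat]
          · rw [this.2, H₂, H₄, tower]
            simp only [map_add, map_mul, map_pow, map_ofNat])
    refine ⟨X, z, hX, hz, Or.inr ?_⟩
    simpa only [map_sub, map_mul, map_pow, map_ofNat] using hXz

variable [CharZero K] in
lemma exists_eq_some_of_two_nsmul [W.IsElliptic] (h₁ : W.a₁ = 0) (h₃ : W.a₃ = 0) [IsGalois K L]
    {T : W.Pts L} (hT0 : T ≠ 0) (hT2 : 2 • T = 0) (hσ : ∀ σ : L ≃ₐ[K] L, σ • T = T) :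
    ∃ (e : K) (h : _), T = .some (algebraMap K L e) 0 h := by
  have : CharZero L := charZero_of_injective_algebraMap (algebraMap K L).injective
  have H₁ : (Affine.baseChange W.toAffine L).a₁ = 0 :=
    (congrArg (algebraMap K L) h₁).trans (map_zero _)
  have H₃ : (Affine.baseChange W.toAffine L).a₃ = 0 :=
    (congrArg (algebraMap K L) h₃).trans (map_zero _)
  rcases T with _ | ⟨x, y, h⟩
  · exact absurd rfl hT0
  obtain rfl := Y_eq_zero_of_two_nsmul H₁ H₃ hT2
  obtain ⟨e, rfl⟩ := (InfiniteGalois.mem_range_algebraMap_iff_fixed (k := K) x).2 fun σ => by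
    obtain ⟨h', e'⟩ := smul_some σ h
    exact ((Affine.Point.some.injEq ..).mp (e'.symm.trans (hσ σ))).1
  exact ⟨e, h, rfl⟩

end

section

variable {K k : Type} [Field K] [CharZero K] [Field k] [Algebra K k] {W : WeierstrassCurve K}
  [W.IsElliptic]

omit [CharZero K] in
lemma nonempty_algHom_algebraicClosure :
    Nonempty (AlgebraicClosure K →ₐ[K] AlgebraicClosure k) :=
  ⟨IsAlgClosed.lift⟩

/-- The class of a quadratic character with values in a rational subgroup of order two that becomes
trivial over an extension `k` of the base field. -/
lemma exists_sq_eq_of_locally_trivial (h₁ : W.a₁ = 0) (h₃ : W.a₃ = 0) {e : K} {hT : _}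
    {f : AbsGal K → W.Pts (AlgebraicClosure K)} {m : K} {s : AlgebraicClosure K}
    (hs : s ^ 2 = algebraMap K _ m)
    (hf : ∀ σ : AbsGal K, (σ s = s ∧ f σ = 0) ∨ (σ s = -s ∧ f σ = .some (algebraMap K _ e) 0 hT))
    {ι : AlgebraicClosure K →ₐ[K] AlgebraicClosure k} {P : W.Pts (AlgebraicClosure k)}
    (hP : ∀ σ : AbsGal k, Pts.map W ι (f (AbsGal.restrict ι σ)) = σ • P - P) :
    ∃ X z : k, X ≠ 0 ∧ z ^ 2 = algebraMap K k m * X ∧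
      (X = 1 ∨ X = algebraMap K k
        ((3 * e + W.a₂) ^ 2 - 4 * (3 * e ^ 2 + 2 * W.a₂ * e + W.a₄)) ∨
      ∃ w, w ^ 2 = X * (X ^ 2 - 2 * algebraMap K k (3 * e + W.a₂) * X + algebraMap K k
        ((3 * e + W.a₂) ^ 2 - 4 * (3 * e ^ 2 + 2 * W.a₂ * e + W.a₄)))) := by
  have : CharZero k := charZero_of_injective_algebraMap (algebraMap K k).injective
  have hT' : (Affine.baseChange W.toAffine (AlgebraicClosure k)).Nonsingular
      (algebraMap K _ e) 0 := by
    have := (Affine.baseChange_nonsingular W.toAffine (f := ι) ι.injective _ _).2 hT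
    rwa [map_zero, ι.commutes] at this
  have hιT : Pts.map W ι (.some (algebraMap K _ e) 0 hT) = .some (algebraMap K _ e) 0 hT' :=
    (Affine.Point.some.injEq ..).mpr ⟨ι.commutes e, map_zero ι⟩
  refine exists_sq_eq_of_smul_eq (k := k) h₁ h₃ hT' P (m := m) (s := ι s)
    (by rw [← map_pow, hs, ι.commutes]) fun σ => ?_
  rw [← AbsGal.restrict_spec]
  refine (hf (AbsGal.restrict ι σ)).imp ?_ ?_
  · rintro ⟨t, t'⟩
    refine ⟨by rw [t], ?_⟩
    have := hP σ
    rw [t', map_zero] at this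
    exact sub_eq_zero.1 this.symm
  · rintro ⟨t, t'⟩
    refine ⟨by rw [t, map_neg], ?_⟩
    have := hP σ
    rw [t', hιT] at this
    rw [this]
    abel

end

end WeierstrassCurve

/-- In each of the three alternatives `X` has even valuation, and `m * X` is a square. -/
lemma even_padicValRat_of_sq_eq {p : ℕ} [Fact p.Prime] {m a D : ℚ} (hm : m ≠ 0)
    (ha : ‖(a : ℚ_[p])‖ ≤ 1) (hD : ‖(D : ℚ_[p])‖ = 1)
    (h : ∃ X z : ℚ_[p], X ≠ 0 ∧ z ^ 2 = algebraMap ℚ _ m * X ∧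
      (X = 1 ∨ X = algebraMap ℚ _ D ∨
        ∃ w, w ^ 2 = X * (X ^ 2 - 2 * algebraMap ℚ _ a * X + algebraMap ℚ _ D))) :
    Even (padicValRat p m) := by
  obtain ⟨X, z, hX, hz, h⟩ := h
  simp only [eq_ratCast] at hz h
  have hm' : (m : ℚ_[p]) ≠ 0 := by exact_mod_cast hm
  have hXe : Even X.valuation := by
    rcases h with rfl | rfl | ⟨w, hw⟩
    · rw [Padic.valuation_one]
      exact Even.zero
    · rw [Padic.valuation_eq_of_norm_eq hX (hD.trans norm_one.symm), Padic.valuation_one]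
      exact Even.zero
    · exact Padic.even_valuation_of_sq_eq hX ha hD hw
  have hv := congrArg Padic.valuation hz
  rw [Padic.valuation_mul hm' hX, Padic.valuation_pow, Padic.valuation_ratCast] at hv
  rw [eq_sub_of_add_eq hv.symm]
  exact (even_two_mul _).sub hXe

/-! ### Galois cohomology of the two-power torsion -/

namespace ContH1

variable {G : Type*} [Group G] [TopologicalSpace G]
variable {M : Type*} [AddCommGroup M] [DistribMulAction G M]
variable {H : Type*} [Group H] [TopologicalSpace H]
variable {N : Type*} [AddCommGroup N] [DistribMulAction H N]

lemma mk_eq_zero_iff (c : cocycles G M) :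
    (QuotientAddGroup.mk c : ContH1 G M) = 0 ↔ ∃ m : M, ∀ g, c.1 g = g • m - m :=
  QuotientAddGroup.eq_zero_iff c

lemma map_mk_eq_zero_iff {r : H →* G} {hr : Continuous r} {j : M →+ N}
    {hj : ∀ (h : H) (m : M), j (r h • m) = h • j m} (c : cocycles G M) :
    map r hr j hj (QuotientAddGroup.mk c) = 0 ↔ ∃ n : N, ∀ h, j (c.1 (r h)) = h • n - n :=
  mk_eq_zero_iff (cocyclesMap r hr j hj c)

end ContH1

/-- The value at `x` is constant on left cosets of the open subgroup fixing the finite extension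
`K(x)`. -/
lemma AbsGal.isLocallyConstant_apply {K : Type} [Field K] (x : AlgebraicClosure K) :
    IsLocallyConstant fun σ : AbsGal K => σ x := by
  rw [IsLocallyConstant.iff_exists_open]
  intro σ
  have : FiniteDimensional K (IntermediateField.adjoin K {x}) :=
    IntermediateField.adjoin.finiteDimensional (Algebra.IsIntegral.isIntegral x)
  refine ⟨{τ | σ⁻¹ * τ ∈ (IntermediateField.adjoin K {x}).fixingSubgroup},
    (IntermediateField.fixingSubgroup_isOpen _).preimage (continuous_const_mul σ⁻¹), ?_, ?_⟩
  · rw [Set.mem_ofPred_eq, inv_mul_cancel]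
    exact one_mem _
  · intro τ hτ
    have := (IntermediateField.mem_fixingSubgroup_iff _ _).1 hτ x
      (IntermediateField.mem_adjoin_simple_self K x)
    rw [AlgEquiv.mul_apply] at this
    have h2 := congrArg σ this
    rwa [← AlgEquiv.mul_apply, mul_inv_cancel, AlgEquiv.one_apply] at h2

namespace WeierstrassCurve

section

variable {K : Type} [Field K] {W W₀ : WeierstrassCurve K}

lemma isLocallyConstant_smul (P : W.Pts (AlgebraicClosure K)) :
    IsLocallyConstant fun σ : AbsGal K => σ • P := by
  rcases P with _ | ⟨x, y, h⟩
  · exact IsLocallyConstant.const _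
  · have hxy := (AbsGal.isLocallyConstant_apply x).prodMk (AbsGal.isLocallyConstant_apply y)
    rw [IsLocallyConstant.iff_exists_open] at hxy ⊢
    intro σ
    obtain ⟨U, hU, hσ, hconst⟩ := hxy σ
    refine ⟨U, hU, hσ, fun τ hτ => ?_⟩
    have := hconst τ hτ
    exact (Affine.Point.some.injEq ..).mpr (Prod.mk.injEq .. ▸ this)

/-- The geometric points. -/
abbrev GeomPts (W : WeierstrassCurve K) : Type := W.Pts (AlgebraicClosure K)

/-- A map on geometric points restricts to the `2`-power torsion. -/
noncomputable def twoPowTorsionMap (ψ : W.GeomPts →+ W₀.GeomPts) :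
    W.twoPowTorsion →+ W₀.twoPowTorsion :=
  (ψ.comp W.twoPowTorsion.subtype).codRestrict _ (by
    rintro ⟨P, n, hn⟩
    exact ⟨n, by
      change 2 ^ n • ψ P = 0
      rw [← map_nsmul, hn, map_zero]⟩)

/-- The map on `H¹` of the `2`-power torsion induced by an equivariant map on geometric points. -/
noncomputable def h1Map (ψ : W.GeomPts →+ W₀.GeomPts)
    (hψ : ∀ (σ : AbsGal K) P, ψ (σ • P) = σ • ψ P) :
    ContH1 (AbsGal K) W.twoPowTorsion →+ ContH1 (AbsGal K) W₀.twoPowTorsion :=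
  ContH1.map (MonoidHom.id _) continuous_id (twoPowTorsionMap ψ)
    (fun σ P => Subtype.ext (hψ σ P.1))

lemma h1Map_h1Map {ψ : W.GeomPts →+ W₀.GeomPts}
    {ψ' : W₀.GeomPts →+ W.GeomPts}
    (hψ : ∀ (σ : AbsGal K) P, ψ (σ • P) = σ • ψ P)
    (hψ' : ∀ (σ : AbsGal K) P, ψ' (σ • P) = σ • ψ' P) (h : ∀ P, ψ' (ψ P) = 2 • P)
    (x : ContH1 (AbsGal K) W.twoPowTorsion) : h1Map ψ' hψ' (h1Map ψ hψ x) = 2 • x := by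
  obtain ⟨c, rfl⟩ := QuotientAddGroup.mk_surjective x
  rw [← QuotientAddGroup.mk_nsmul]
  refine congrArg (QuotientAddGroup.mk (s := _)) (Subtype.ext (funext fun σ => Subtype.ext ?_))
  exact h _

/-- The kernel on `H¹` consists of the classes of cocycles with values in the kernel. -/
lemma exists_cocycle_of_h1Map_eq_zero
    {ψ : W.GeomPts →+ W₀.GeomPts}
    {ψ' : W₀.GeomPts →+ W.GeomPts}
    (hψ : ∀ (σ : AbsGal K) P, ψ (σ • P) = σ • ψ P) (h : ∀ P, ψ' (ψ P) = 2 • P)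
    (hsurj : Function.Surjective ψ) {x : ContH1 (AbsGal K) W.twoPowTorsion}
    (hx : h1Map ψ hψ x = 0) :
    ∃ c : ContH1.cocycles (AbsGal K) W.twoPowTorsion, QuotientAddGroup.mk c = x ∧
      ∀ σ, ψ (c.1 σ).1 = 0 := by
  obtain ⟨f, rfl⟩ := QuotientAddGroup.mk_surjective x
  obtain ⟨⟨Q, n, hQ⟩, hfQ⟩ := (ContH1.map_mk_eq_zero_iff f).1 hx
  obtain ⟨P, rfl⟩ := hsurj Q
  -- One extra factor of `2` is absorbed by `ψ' (ψ P) = 2 • P`, so the preimage `P` of `Q` is still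
  -- `2`-power torsion and its coboundary `b` may be subtracted within the same module.
  have hP : P ∈ W.twoPowTorsion := ⟨n + 1, by
    rw [pow_succ, mul_smul, ← h, ← map_nsmul, hQ, map_zero]⟩
  let b : ContH1.cocycles (AbsGal K) W.twoPowTorsion :=
    ⟨fun σ => σ • ⟨P, hP⟩ - ⟨P, hP⟩, by
      have h1 := isLocallyConstant_smul P
      rw [IsLocallyConstant.iff_exists_open] at h1 ⊢
      intro σ
      obtain ⟨U, hU, hσ, hconst⟩ := h1 σ
      exact ⟨U, hU, hσ, fun τ hτ => congrArg (· - _) (Subtype.ext (hconst τ hτ))⟩,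
      fun g h => by
        dsimp only
        rw [smul_sub, mul_smul]
        abel⟩
  refine ⟨f - b, ?_, fun σ => ?_⟩
  · rw [QuotientAddGroup.mk_sub, (ContH1.mk_eq_zero_iff b).2 ⟨⟨P, hP⟩, fun _ => rfl⟩, sub_zero]
  · have h1 : ψ (f.1 σ).1 = σ • ψ P - ψ P := congrArg Subtype.val (hfQ σ)
    change ψ ((f.1 σ).1 - (σ • P - P)) = 0
    rw [map_sub, map_sub, hψ, h1, sub_self]

/-- A function on the absolute Galois group becomes a coboundary over the extension `k`. -/
def LocallyTrivialAt (W : WeierstrassCurve K) (k : Type) [Field k] [Algebra K k]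
    (f : AbsGal K → W.GeomPts) : Prop :=
  ∀ ι : AlgebraicClosure K →ₐ[K] AlgebraicClosure k, ∃ P : W.Pts (AlgebraicClosure k),
    ∀ σ : AbsGal k, Pts.map W ι (f (AbsGal.restrict ι σ)) = σ • P - P

lemma mk_mem_iInf_localization_ker (k : Type) [Field k] [Algebra K k]
    (c : ContH1.cocycles (AbsGal K) W.twoPowTorsion) :
    QuotientAddGroup.mk c ∈ (⨅ ι, (W.localization k ι).ker) ↔
      W.LocallyTrivialAt k fun σ => (c.1 σ).1 := by
  rw [AddSubgroup.mem_iInf]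
  exact forall_congr' fun ι => ContH1.map_mk_eq_zero_iff c

/-- `ψ` extends to an equivariant map on points over the algebraic closure of every extension. -/
def ExtendsLocally (ψ : W.GeomPts →+ W₀.GeomPts) : Prop :=
  ∀ (k : Type) [Field k] [Algebra K k] (ι : AlgebraicClosure K →ₐ[K] AlgebraicClosure k),
    ∃ ψk : W.Pts (AlgebraicClosure k) →+ W₀.Pts (AlgebraicClosure k),
      (∀ (σ : AbsGal k) P, ψk (σ • P) = σ • ψk P) ∧
      ∀ P, ψk (Pts.map W ι P) = Pts.map W₀ ι (ψ P)

lemma LocallyTrivialAt.comp {ψ : W.GeomPts →+ W₀.GeomPts}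
    (hψ : ExtendsLocally ψ) {k : Type} [Field k] [Algebra K k]
    {f : AbsGal K → W.GeomPts} (hf : W.LocallyTrivialAt k f) :
    W₀.LocallyTrivialAt k fun σ => ψ (f σ) := by
  intro ι
  obtain ⟨ψk, h1, h2⟩ := hψ k ι
  obtain ⟨P, hP⟩ := hf ι
  refine ⟨ψk P, fun σ => ?_⟩
  rw [← h2, hP, map_sub, h1]

end

lemma mk_mem_selmer_iff {W : WeierstrassCurve ℚ}
    (c : ContH1.cocycles (AbsGal ℚ) W.twoPowTorsion) :
    QuotientAddGroup.mk c ∈ W.selmer ↔ (W.LocallyTrivialAt ℝ fun σ => (c.1 σ).1) ∧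
      ∀ (p : ℕ) [Fact p.Prime], W.LocallyTrivialAt ℚ_[p] fun σ => (c.1 σ).1 := by
  rw [selmer, AddSubgroup.mem_inf, mk_mem_iInf_localization_ker]
  simp only [AddSubgroup.mem_iInf (ι := ℕ), AddSubgroup.mem_iInf (ι := Fact _),
    mk_mem_iInf_localization_ker]

lemma h1Map_mem_selmer {W W₀ : WeierstrassCurve ℚ}
    {ψ : W.GeomPts →+ W₀.GeomPts} (hψ : _)
    (hloc : ExtendsLocally ψ) {x : _} (hx : x ∈ W.selmer) : h1Map ψ hψ x ∈ W₀.selmer := by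
  obtain ⟨c, rfl⟩ := QuotientAddGroup.mk_surjective x
  rw [mk_mem_selmer_iff] at hx
  exact (mk_mem_selmer_iff _).2 ⟨hx.1.comp hloc, fun p _ => (hx.2 p).comp hloc⟩

end WeierstrassCurve

/-! ### Locally trivial cocycles with values in a subgroup of order two -/

namespace WeierstrassCurve

section

variable {K : Type} [Field K] [CharZero K] {W : WeierstrassCurve K}

/-- A cocycle with values in a rational subgroup `{0, T}` of order two is cut out by a square
root. -/
lemma exists_sqrt_of_cocycle {T : W.GeomPts} (hT2 : 2 • T = 0)
    (hT : ∀ σ : AbsGal K, σ • T = T) {f : AbsGal K → W.GeomPts} (hlc : IsLocallyConstant f)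
    (hf : ∀ g h, f (g * h) = f g + g • f h) (hval : ∀ g, f g = 0 ∨ f g = T) :
    ∃ (N : Subgroup (AbsGal K)) (m : K) (s : AlgebraicClosure K), (N : Set (AbsGal K)) = f ⁻¹' {0} ∧
      m ≠ 0 ∧ s ^ 2 = algebraMap K _ m ∧ ∀ σ : AbsGal K, σ ∈ N ↔ σ s = s := by
  -- As `T` is fixed by Galois, the cocycle is a homomorphism, and its zero set is an open subgroup
  -- of index at most two.
  have hadd : ∀ g h, f (g * h) = f g + f h := by
    intro g h
    rw [hf]
    rcases hval h with t | t
    · rw [t, smul_zero]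
    · rw [t, hT]
  have hone : f 1 = 0 := by
    have := hadd 1 1
    rwa [mul_one, left_eq_add] at this
  let N : Subgroup (AbsGal K) :=
    { carrier := f ⁻¹' {0}
      mul_mem' := by
        intro a b ha hb
        change f (a * b) = 0
        rw [hadd, show f a = 0 from ha, show f b = 0 from hb, add_zero]
      one_mem' := hone
      inv_mem' := by
        intro a ha
        have := hadd a⁻¹ a
        rw [inv_mul_cancel, hone, show f a = 0 from ha, add_zero] at this
        exact this.symm }
  obtain ⟨m, s, hm, hs, h⟩ := AbsGal.exists_sqrt_of_isOpen N (hlc {0}) (by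
    intro σ τ hσ hτ
    change f (σ * τ) = 0
    rw [hadd, (hval σ).resolve_left hσ, (hval τ).resolve_left hτ, ← two_nsmul, hT2])
  exact ⟨N, m, s, rfl, hm, hs, h⟩

end

/-- The everywhere locally trivial cocycles with values in a rational subgroup of order two form a
finite set. -/
lemma finite_locallyTrivial {W : WeierstrassCurve ℚ} [W.IsElliptic] (h₁ : W.a₁ = 0)
    (h₃ : W.a₃ = 0) {T : W.GeomPts} (hT0 : T ≠ 0) (hT2 : 2 • T = 0)
    (hT : ∀ σ : AbsGal ℚ, σ • T = T) :
    {f : AbsGal ℚ → W.GeomPts | IsLocallyConstant f ∧ (∀ g h, f (g * h) = f g + g • f h) ∧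
      (∀ g, f g = 0 ∨ f g = T) ∧
      ∀ (p : ℕ) [Fact p.Prime], W.LocallyTrivialAt ℚ_[p] f}.Finite := by
  obtain ⟨e, hns, rfl⟩ := exists_eq_some_of_two_nsmul h₁ h₃ hT0 hT2 hT
  set a := 3 * e + W.a₂ with ha
  set D := (3 * e + W.a₂) ^ 2 - 4 * (3 * e ^ 2 + 2 * W.a₂ * e + W.a₄) with hD
  have hD0 : D ≠ 0 := (ne_zero_of_equation h₁ h₃ hns.1).2
  -- A function with values in `{0, T}` is determined by its zero set. The excluded primes divide a
  -- denominator of `a`, `D` or `D⁻¹`; elsewhere `a` is integral and `D` is a unit. The sign of `m`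
  -- stays free, so the finite places suffice.
  refine Set.Finite.of_finite_image (f := fun f => f ⁻¹' {0})
    (((AbsGal.finite_quadratic (a.den * D.den * D⁻¹.den).primeFactors).image
      (fun N : Subgroup (AbsGal ℚ) => (N : Set (AbsGal ℚ)))).subset ?_) ?_
  · rintro _ ⟨f, ⟨hlc, hf, hval, hloc⟩, rfl⟩
    obtain ⟨N, m, s, hN, hm, hs, h⟩ := exists_sqrt_of_cocycle hT2 hT hlc hf hval
    refine ⟨N, ⟨m, s, hm, by rw [hs, eq_ratCast], h, fun p hp hpS => ?_⟩, hN⟩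
    have : Fact p.Prime := ⟨hp⟩
    have hnd : ¬ p ∣ a.den * D.den * D⁻¹.den := fun t =>
      hpS (Nat.mem_primeFactors.2 ⟨hp, t, mul_ne_zero (mul_ne_zero a.den_ne_zero D.den_ne_zero)
        D⁻¹.den_ne_zero⟩)
    rw [hp.dvd_mul, hp.dvd_mul, not_or, not_or] at hnd
    have hDn : ‖(D : ℚ_[p])‖ = 1 := by
      refine le_antisymm (Padic.norm_rat_le_one hnd.1.2) ?_
      have := Padic.norm_rat_le_one hnd.2
      rw [Rat.cast_inv, norm_inv] at this
      exact (inv_le_one₀ (norm_pos_iff.2 (by exact_mod_cast hD0))).1 this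
    obtain ⟨ι⟩ := nonempty_algHom_algebraicClosure (K := ℚ) (k := ℚ_[p])
    obtain ⟨P, hP⟩ := hloc p ι
    refine even_padicValRat_of_sq_eq hm (Padic.norm_rat_le_one hnd.1.1) hDn
      (exists_sq_eq_of_locally_trivial (hT := hns) h₁ h₃ hs (fun σ => ?_) hP)
    have hσN : σ ∈ N ↔ f σ = 0 := by rw [← SetLike.mem_coe, hN]; rfl
    by_cases hσ : σ ∈ N
    · exact Or.inl ⟨(h σ).1 hσ, hσN.1 hσ⟩
    · refine Or.inr ⟨?_, (hval σ).resolve_left fun t => hσ (hσN.2 t)⟩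
      refine (sq_eq_sq_iff_eq_or_eq_neg.1 ?_).resolve_left fun t => hσ ((h σ).2 t)
      rw [← map_pow, hs, AlgEquiv.commutes]
  · intro f hf f' hf' h
    funext σ
    have hσ : f σ = 0 ↔ f' σ = 0 := Iff.of_eq (congrArg (σ ∈ ·) h)
    rcases hf.2.2.1 σ with t | t <;> rcases hf'.2.2.1 σ with t' | t'
    · rw [t, t']
    · exact absurd (t'.symm.trans (hσ.1 t)) hT0
    · exact absurd (t.symm.trans (hσ.2 t')) hT0
    · rw [t, t']

end WeierstrassCurve

/-! ### Kernels of two maps composing to multiplication by two -/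

section Kernels

variable {B C : Type*} [AddCommGroup B] [AddCommGroup C]

lemma AddSubgroup.exists_forall_eq_of_card_le_two (N : AddSubgroup B) [Finite N]
    (h : Nat.card N ≤ 2) : ∃ T ∈ N, ∀ P ∈ N, P = 0 ∨ P = T := by
  by_contra! hcon
  obtain ⟨T, hT, hT0, -⟩ := hcon 0 N.zero_mem
  obtain ⟨P, hP, hP0, hPT⟩ := hcon T hT
  have : ({0, ⟨T, hT⟩, ⟨P, hP⟩} : Finset N).card = 3 := by
    rw [Finset.card_eq_three]
    exact ⟨0, ⟨T, hT⟩, ⟨P, hP⟩, fun t => hT0 (congrArg Subtype.val t).symm,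
      fun t => hP0 (congrArg Subtype.val t).symm, fun t => hPT (congrArg Subtype.val t).symm, rfl⟩
  have h3 := Nat.card_mono (Set.toFinite (Set.univ : Set N))
    (Set.subset_univ (({0, ⟨T, hT⟩, ⟨P, hP⟩} : Finset N) : Set N))
  rw [Nat.card_coe_set_eq, Set.ncard_coe_finset, this, Nat.card_univ] at h3
  lia

/-- As `ψ` is onto, it maps the `2`-torsion of `B` onto `ker ψ'` with kernel `ker ψ` of order two;
the source has at most four elements. -/
lemma AddMonoidHom.card_ker_le_two_of_comp_eq_two {ψ : B →+ C} {ψ' : C →+ B}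
    (h : ∀ x, ψ' (ψ x) = 2 • x) (hsurj : Function.Surjective ψ) (hker : Nat.card ψ.ker = 2)
    (hfin : {x : B | 2 • x = 0}.Finite) (h4 : {x : B | 2 • x = 0}.ncard ≤ 4) :
    Finite ψ'.ker ∧ Nat.card ψ'.ker ≤ 2 := by
  let M : AddSubgroup B := (nsmulAddMonoidHom 2 : B →+ B).ker
  have hM : Nat.card M ≤ 4 := h4
  have : Finite M := hfin.to_subtype
  let f : M →+ ψ'.ker := (ψ.comp M.subtype).codRestrict _ fun x => (h x.1).trans x.2
  have hf : Function.Surjective f := by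
    rintro ⟨c, hc⟩
    obtain ⟨b, rfl⟩ := hsurj c
    exact ⟨⟨b, (h b).symm.trans hc⟩, rfl⟩
  have hfk : Nat.card f.ker = 2 := by
    rw [← hker]
    refine Nat.card_congr ⟨fun x => ⟨x.1.1, congrArg Subtype.val x.2⟩,
      fun x => ⟨⟨x.1, ?_⟩, Subtype.ext x.2⟩, fun _ => rfl, fun _ => rfl⟩
    change 2 • x.1 = 0
    rw [← h, show ψ x.1 = 0 from x.2, map_zero]
  refine ⟨Finite.of_surjective f hf, ?_⟩
  rw [AddSubgroup.card_eq_card_quotient_mul_card_addSubgroup f.ker, hfk,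
    Nat.card_congr (QuotientAddGroup.quotientKerEquivOfSurjective f hf).toEquiv] at hM
  lia

/-- On elements of `A` killed by `2`, `ψ` takes values in the finite kernel of `ψ'` on `A'`, and its
fibres lie in translates of the finite kernel of `ψ` on `A`. -/
lemma AddMonoidHom.finite_two_torsion_of_comp_eq_two {A : AddSubgroup B} {A' : AddSubgroup C}
    {ψ : B →+ C} {ψ' : C →+ B} (hψ : ∀ x ∈ A, ψ x ∈ A') (h : ∀ x, ψ' (ψ x) = 2 • x)
    (hA : {x : B | x ∈ A ∧ ψ x = 0}.Finite) (hA' : {x : C | x ∈ A' ∧ ψ' x = 0}.Finite) :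
    {x : B | x ∈ A ∧ 2 • x = 0}.Finite := by
  refine Set.Finite.of_finite_fibers ψ (hA'.subset ?_) fun y _ => ?_
  · rintro _ ⟨x, ⟨hx, hx2⟩, rfl⟩
    exact ⟨hψ x hx, (h x).trans hx2⟩
  · by_cases hy : ∃ x₀, x₀ ∈ A ∧ ψ x₀ = y
    · obtain ⟨x₀, hx₀, rfl⟩ := hy
      refine (hA.image (· + x₀)).subset ?_
      rintro x ⟨⟨hx, -⟩, hxy⟩
      exact ⟨x - x₀, ⟨A.sub_mem hx hx₀, by rw [map_sub, sub_eq_zero]; exact hxy⟩,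
        sub_add_cancel _ _⟩
    · refine Set.finite_empty.subset ?_
      rintro x ⟨⟨hx, -⟩, hxy⟩
      exact hy ⟨x, hx, hxy⟩

end Kernels

/-! ### Finiteness of Selmer kernels and the corank formula -/

namespace WeierstrassCurve

/-- Finiteness of the classes in the Selmer group killed by an isogeny with kernel of order at
most `2`. -/
lemma finite_selmer_inf_ker {W W₀ : WeierstrassCurve ℚ} [W.IsElliptic] (h₁ : W.a₁ = 0)
    (h₃ : W.a₃ = 0) {ψ : W.GeomPts →+ W₀.GeomPts} {ψ' : W₀.GeomPts →+ W.GeomPts}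
    (hψ : ∀ (σ : AbsGal ℚ) P, ψ (σ • P) = σ • ψ P) (h : ∀ P, ψ' (ψ P) = 2 • P)
    (hsurj : Function.Surjective ψ) [Finite ψ.ker] (hker : Nat.card ψ.ker ≤ 2) :
    {x | x ∈ W.selmer ∧ h1Map ψ hψ x = 0}.Finite := by
  obtain ⟨T, hTker, hT⟩ := ψ.ker.exists_forall_eq_of_card_le_two hker
  choose! c hc hcψ using fun x (hx : x ∈ {x | x ∈ W.selmer ∧ h1Map ψ hψ x = 0}) =>
    exists_cocycle_of_h1Map_eq_zero hψ h hsurj hx.2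
  refine Set.Finite.of_finite_image (f := fun x => fun σ => ((c x).1 σ).1) ?_ ?_
  -- The kernel is only known to have order at most two. If it is trivial, the chosen cocycles all
  -- vanish.
  · by_cases hT0 : T = 0
    · refine (Set.finite_singleton (fun _ => 0)).subset ?_
      rintro _ ⟨x, hx, rfl⟩
      funext σ
      rcases hT _ (hcψ x hx σ) with t | t
      · exact t
      · exact t.trans hT0
    · have hT2 : 2 • T = 0 := by rw [← h, show ψ T = 0 from hTker, map_zero]
      have hTσ : ∀ σ : AbsGal ℚ, σ • T = T := fun σ => by
        refine (hT (σ • T) ?_).resolve_left fun t => hT0 ((smul_eq_zero_iff_eq σ).1 t)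
        rw [AddMonoidHom.mem_ker, hψ, show ψ T = 0 from hTker, smul_zero]
      refine (finite_locallyTrivial h₁ h₃ hT0 hT2 hTσ).subset ?_
      rintro _ ⟨x, hx, rfl⟩
      refine ⟨(c x).2.1.comp Subtype.val, fun g h => congrArg Subtype.val ((c x).2.2 g h),
        fun g => hT _ (hcψ x hx g), ?_⟩
      have := hx.1
      rw [← hc x hx, mk_mem_selmer_iff] at this
      exact this.2
  · intro x hx y hy hxy
    rw [← hc x hx, ← hc y hy]
    congr 1
    exact Subtype.ext (funext fun σ => Subtype.ext (congrFun hxy σ))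

/-- The Selmer corank in terms of the `2`-torsion of the divisible part. -/
lemma selmerCorankExists_and_two_pow_selmerCorank {W : WeierstrassCurve ℚ}
    (hfin : {x | x ∈ W.selmer ∧ 2 • x = 0}.Finite) :
    W.SelmerCorankExists ∧
      2 ^ W.selmerCorank = Nat.card W.selmer.divisibleElements.twoTorsion := by
  have hfin' : {x : W.selmer | 2 • x = 0}.Finite := by
    refine Set.Finite.of_finite_image (f := Subtype.val) (hfin.subset ?_)
      Subtype.val_injective.injOn
    rintro _ ⟨x, hx, rfl⟩
    exact ⟨x.2, congrArg Subtype.val hx⟩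
  -- The index shifts by one: elements of order two in `ℤ/2^(k+1)` are divisible by `2 ^ k`.
  -- Exponent `0` is left out, as powers of the trivial group `ℤ/1` embed for every `r`.
  have hset : ∀ k, W.selmerRankSet (k + 1) =
      Set.Iic (Nat.log 2 (Nat.card (AddSubgroup.divSocle W.selmer k))) := fun k =>
    Set.ext fun r => AddSubgroup.exists_injective_iff hfin'
  have hgreat : ∀ k, IsGreatest (W.selmerRankSet (k + 1))
      (Nat.log 2 (Nat.card (AddSubgroup.divSocle W.selmer k))) := fun k => by
    rw [hset]
    exact isGreatest_Iic
  have hrank : ∀ k, W.selmerRank (k + 1) =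
      Nat.log 2 (Nat.card (AddSubgroup.divSocle W.selmer k)) := fun k => (hgreat k).csSup_eq
  obtain ⟨k₀, hk₀⟩ := AddSubgroup.exists_forall_mem_divSocle hfin'
  have hcard : ∀ k ≥ k₀, Nat.card (AddSubgroup.divSocle W.selmer k) =
      Nat.card W.selmer.divisibleElements.twoTorsion := by
    intro k hk
    have hmem := fun x => (hk₀ k hk x).trans (AddSubgroup.mem_divSocle_forall_iff x)
    exact Nat.card_congr ⟨fun x => ⟨x.1.1, (hmem x.1).1 x.2⟩,
      fun x => ⟨⟨x.1, x.2.1.1⟩, (hmem _).2 x.2⟩, fun _ => rfl, fun _ => rfl⟩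
  have htend : Filter.Tendsto W.selmerRank Filter.atTop
      (nhds (Nat.log 2 (Nat.card W.selmer.divisibleElements.twoTorsion))) := by
    refine tendsto_const_nhds.congr' ?_
    filter_upwards [Filter.eventually_ge_atTop (k₀ + 1)] with k hk
    obtain ⟨k, rfl⟩ : ∃ j, k = j + 1 := ⟨k - 1, by lia⟩
    rw [hrank, hcard k (by lia)]
  have hlim : W.selmerCorank = Nat.log 2 (Nat.card W.selmer.divisibleElements.twoTorsion) :=
    htend.limUnder_eq
  refine ⟨⟨fun k hk => ?_, hlim ▸ htend⟩, ?_⟩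
  · obtain ⟨k, rfl⟩ : ∃ j, k = j + 1 := ⟨k - 1, by lia⟩
    rw [hrank]
    exact hgreat k
  · have : Finite W.selmer.divisibleElements.twoTorsion :=
      (hfin.subset fun x hx => ⟨hx.1.1, hx.2⟩).to_subtype
    let : Module (ZMod 2) W.selmer.divisibleElements.twoTorsion :=
      AddCommGroup.zmodModule (n := 2) fun x => Subtype.ext x.2.2
    -- The order is an exact power of two, so the integer logarithm loses nothing.
    rw [hlim, Module.natCard_eq_pow_finrank (K := ZMod 2), Nat.card_zmod, Nat.log_pow one_lt_two]

/-- The Selmer corank in terms of the kernels of two equivariant maps that compose to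
multiplication by `2`. -/
lemma two_pow_selmerCorank_eq {W W₀ : WeierstrassCurve ℚ} {ψ : W.GeomPts →+ W₀.GeomPts}
    {ψ' : W₀.GeomPts →+ W.GeomPts} (hψ : ∀ (σ : AbsGal ℚ) P, ψ (σ • P) = σ • ψ P)
    (hψ' : ∀ (σ : AbsGal ℚ) P, ψ' (σ • P) = σ • ψ' P) (h : ∀ P, ψ' (ψ P) = 2 • P)
    (h' : ∀ P, ψ (ψ' P) = 2 • P) (hloc : ExtendsLocally ψ) (hloc' : ExtendsLocally ψ')
    (hf : {x | x ∈ W.selmer ∧ h1Map ψ hψ x = 0}.Finite)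
    (hf' : {x | x ∈ W₀.selmer ∧ h1Map ψ' hψ' x = 0}.Finite) :
    W.SelmerCorankExists ∧ 2 ^ W.selmerCorank =
      Nat.card ↥((h1Map ψ hψ).ker ⊓ W.selmer.divisibleElements) *
        Nat.card ↥((h1Map ψ' hψ').ker ⊓ W₀.selmer.divisibleElements) := by
  have hsel : ∀ x ∈ W.selmer, h1Map ψ hψ x ∈ W₀.selmer := fun x => h1Map_mem_selmer hψ hloc
  have hsel' : ∀ x ∈ W₀.selmer, h1Map ψ' hψ' x ∈ W.selmer := fun x => h1Map_mem_selmer hψ' hloc'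
  have hh := h1Map_h1Map hψ hψ' h
  have hh' := h1Map_h1Map hψ' hψ h'
  have h2 := AddMonoidHom.finite_two_torsion_of_comp_eq_two hsel hh hf hf'
  have h2' := AddMonoidHom.finite_two_torsion_of_comp_eq_two hsel' hh' hf' hf
  obtain ⟨hex, hrk⟩ := selmerCorankExists_and_two_pow_selmerCorank h2
  exact ⟨hex, hrk.trans (AddSubgroup.card_twoTorsion_divisibleElements hsel hsel' hh hh' h2')⟩

/-! ### The isogenies between quadratic twists -/

namespace Isogeny

section

variable {K : Type} [Field K] [CharZero K] {E E₀ : WeierstrassCurve K} (φ : Isogeny E E₀)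
  {φ' : Isogeny E₀ E} {d : K} (hd : d ≠ 0)

lemma twistHom_twistHom (hφ : φ.degree = 2) (hφ' : φ.IsDual φ')
    (P : (E.twist d).GeomPts) : φ'.twistHom hd (φ.twistHom hd P) = 2 • P := by
  obtain ⟨P, rfl⟩ := (twistEquiv E hd (sqrtClosure_sq d)).surjective P
  simp [twistHom, hφ'.1, hφ]

lemma twistHom_twistHom' (hφ : φ.degree = 2) (hφ' : φ.IsDual φ')
    (P : (E₀.twist d).GeomPts) : φ.twistHom hd (φ'.twistHom hd P) = 2 • P := by
  obtain ⟨P, rfl⟩ := (twistEquiv E₀ hd (sqrtClosure_sq d)).surjective P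
  simp [twistHom, hφ'.2, hφ]

lemma card_ker_twistHom : Nat.card (φ.twistHom hd).ker = φ.degree := by
  let e := twistEquiv E hd (sqrtClosure_sq d)
  have key : ∀ P, φ.twistHom hd (e P) = 0 ↔ φ.hom (AlgebraicClosure K) P = 0 := fun P => by
    simp [twistHom, e]
  exact (Nat.card_congr (e.toEquiv.subtypeEquiv fun P => (key P).symm)).symm

/-- Over `k` the twisted isogeny is again the conjugate of `φ` by twisting isomorphisms, built from
the image under `ι` of the chosen square root of `d` so that it agrees with the map over `K`. -/
lemma extendsLocally_twistHom : ExtendsLocally (φ.twistHom hd) := by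
  intro k _ _ ι
  have : CharZero k := charZero_of_injective_algebraMap (algebraMap K k).injective
  set s := ι (sqrtClosure d) with hs
  have hs2 : s ^ 2 = algebraMap K (AlgebraicClosure k) d := by
    rw [hs, ← map_pow, sqrtClosure_sq, ι.commutes]
  let e := twistEquiv E hd hs2
  let e₀ := twistEquiv E₀ hd hs2
  have hmap : ∀ (F : WeierstrassCurve K) (P : F.GeomPts),
      Pts.map (F.twist d) ι (twistEquiv F hd (sqrtClosure_sq d) P) =
        twistEquiv F hd hs2 (Pts.map F ι P) := by
    intro F P
    rcases P with _ | ⟨x, y, h⟩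
    · rfl
    · refine (Affine.Point.some.injEq ..).mpr ?_
      have h2 : ι 2 = 2 := map_ofNat ι 2
      simp [hs, h2]
  refine ⟨(e₀.toAddMonoidHom.comp (φ.hom (AlgebraicClosure k))).comp e.symm.toAddMonoidHom,
    fun σ Q => ?_, fun Q => ?_⟩
  · obtain ⟨P, rfl⟩ := e.surjective Q
    let τ : AlgebraicClosure k ≃ₐ[K] AlgebraicClosure k := σ.restrictScalars K
    have hφ : φ.hom (AlgebraicClosure k) (τ • P) = τ • φ.hom (AlgebraicClosure k) P :=
      φ.hom_map _ _ _ P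
    have h : τ s ^ 2 = s ^ 2 := by rw [← map_pow, hs2, AlgEquiv.commutes]
    change e₀ (φ.hom _ (e.symm (τ • e P))) = τ • e₀ (φ.hom _ (e.symm (e P)))
    rw [AddEquiv.symm_apply_apply]
    -- An automorphism negating `√d` introduces a sign on both twists, and the two signs cancel
    -- because `φ` is additive.
    rcases sq_eq_sq_iff_eq_or_eq_neg.1 h with h | h
    · rw [smul_twistEquiv E hd hs2 τ h, smul_twistEquiv E₀ hd hs2 τ h, ← hφ]
      exact congrArg (fun R => e₀ (φ.hom _ R)) (e.symm_apply_apply _)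
    · rw [smul_twistEquiv' E hd hs2 τ h, smul_twistEquiv' E₀ hd hs2 τ h, ← hφ, map_neg]
      refine (congrArg (fun R => e₀ (φ.hom _ (-R))) (e.symm_apply_apply _)).trans ?_
      rw [map_neg, map_neg]
  · obtain ⟨P, rfl⟩ := (twistEquiv E hd (sqrtClosure_sq d)).surjective Q
    rw [hmap]
    change e₀ (φ.hom _ (e.symm (e (Pts.map E ι P)))) = _
    rw [AddEquiv.symm_apply_apply, φ.hom_map]
    simp only [twistHom, AddMonoidHom.comp_apply, AddEquiv.toAddMonoidHom_eq_coe,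
      AddMonoidHom.coe_coe, AddEquiv.symm_apply_apply]
    exact (hmap E₀ _).symm

include hd in
lemma twist_exists_two_nsmul_eq (E : WeierstrassCurve K) [E.IsElliptic] (P : (E.twist d).GeomPts) :
    ∃ Q : (E.twist d).GeomPts, 2 • Q = P := by
  have := twist_isElliptic E hd
  have : (Affine.baseChange (E.twist d).toAffine (AlgebraicClosure K)).IsElliptic :=
    inferInstanceAs ((E.twist d).map (algebraMap K (AlgebraicClosure K))).IsElliptic
  exact exists_two_nsmul_eq (W := Affine.baseChange (E.twist d).toAffine (AlgebraicClosure K))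
    (map_zero _) (map_zero _) P

/-- Geometric points can be halved, and `2 • R` is the image of the dual isogeny applied to `R`. -/
lemma twistHom_surjective [E₀.IsElliptic] (hφ : φ.degree = 2) (hφ' : φ.IsDual φ') :
    Function.Surjective (φ.twistHom hd) := by
  intro Q
  obtain ⟨R, rfl⟩ := twist_exists_two_nsmul_eq hd E₀ Q
  exact ⟨φ'.twistHom hd R, twistHom_twistHom' φ hd hφ hφ' R⟩

lemma twistHom_dual_surjective [E.IsElliptic] (hφ : φ.degree = 2) (hφ' : φ.IsDual φ') :
    Function.Surjective (φ'.twistHom hd) := by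
  intro P
  obtain ⟨R, rfl⟩ := twist_exists_two_nsmul_eq hd E P
  exact ⟨φ.twistHom hd R, twistHom_twistHom φ hd hφ hφ' R⟩

lemma card_ker_twistHom_dual_le [E₀.IsElliptic] (hφ : φ.degree = 2) (hφ' : φ.IsDual φ') :
    Finite (φ'.twistHom hd).ker ∧ Nat.card (φ'.twistHom hd).ker ≤ 2 := by
  obtain ⟨h1, h2⟩ := finite_two_torsion_and_ncard_le
    (W := Affine.baseChange (E.twist d).toAffine (AlgebraicClosure K))
    (map_zero _) (map_zero _)
  exact AddMonoidHom.card_ker_le_two_of_comp_eq_two (twistHom_twistHom φ hd hφ hφ')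
    (twistHom_surjective φ hd hφ hφ') ((card_ker_twistHom φ hd).trans hφ) h1 h2

end

section

variable {E E₀ : WeierstrassCurve ℚ} (φ : Isogeny E E₀) {d : ℚ} (hd : d ≠ 0)

/-- This is exactness at the middle term of `H¹(ker φ) → H¹(E^d[2^∞]) → H¹(E₀^d[2^∞])`; surjectivity
on points lets a class in the kernel be represented by a cocycle with values in `ker φ`. -/
lemma divPart_eq (h : φ.KerTwo) {ψ' : (E₀.twist d).GeomPts →+ (E.twist d).GeomPts}
    (h2 : ∀ P, ψ' (φ.twistHom hd P) = 2 • P) (hsurj : Function.Surjective (φ.twistHom hd)) :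
    φ.divPart h hd = (h1Map (φ.twistHom hd) (φ.twistHom_smul hd)).ker ⊓
      (E.twist d).selmer.divisibleElements := by
  refine congrArg (· ⊓ _) (le_antisymm ?_ ?_)
  · rintro _ ⟨c, rfl⟩
    obtain ⟨f, rfl⟩ := QuotientAddGroup.mk_surjective c
    refine (ContH1.mk_eq_zero_iff _).2 ⟨0, fun σ => ?_⟩
    rw [smul_zero, sub_zero]
    exact Subtype.ext (f.1 σ).2
  · intro x hx
    obtain ⟨c, rfl, hc⟩ := exists_cocycle_of_h1Map_eq_zero (φ.twistHom_smul hd) h2 hsurj hx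
    refine ⟨QuotientAddGroup.mk ⟨fun σ => ⟨(c.1 σ).1, hc σ⟩, ?_, fun g h => ?_⟩, rfl⟩
    · exact IsLocallyConstant.desc _ Subtype.val (c.2.1.comp Subtype.val) Subtype.val_injective
    · have := congrArg Subtype.val (c.2.2 g h)
      exact Subtype.ext this

lemma finite_divPart_and_card (h : φ.KerTwo)
    {ψ' : (E₀.twist d).GeomPts →+ (E.twist d).GeomPts}
    (h2 : ∀ P, ψ' (φ.twistHom hd P) = 2 • P) (hsurj : Function.Surjective (φ.twistHom hd))
    (hf : {x | x ∈ (E.twist d).selmer ∧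
      h1Map (φ.twistHom hd) (φ.twistHom_smul hd) x = 0}.Finite) :
    Module.Finite (ZMod 2) (φ.divPart h hd) ∧
      Nat.card ↥((h1Map (φ.twistHom hd) (φ.twistHom_smul hd)).ker ⊓
        (E.twist d).selmer.divisibleElements) = 2 ^ φ.divRank h hd := by
  have heq := φ.divPart_eq hd h h2 hsurj
  have hfin : Finite (φ.divPart h hd) := by
    rw [heq]
    exact (hf.subset fun x hx => ⟨hx.2.1, hx.1⟩).to_subtype
  refine ⟨Module.Finite.of_finite, ?_⟩
  rw [← heq, Module.natCard_eq_pow_finrank (K := ZMod 2), Nat.card_zmod]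
  rfl

end

variable {E E₀ : WeierstrassCurve ℚ} [E.IsElliptic] [E₀.IsElliptic]

theorem selmerCorank_twist_eq (φ : Isogeny E E₀) (hφ : φ.degree = 2) (φ' : Isogeny E₀ E)
    (hφ' : φ.IsDual φ') {d : ℚ} (hd : d ≠ 0) :
    (E.twist d).SelmerCorankExists ∧ (E₀.twist d).SelmerCorankExists ∧
    Module.Finite (ZMod 2) (φ.divPart (kerTwo hφ) hd) ∧
    Module.Finite (ZMod 2) (φ'.divPart (hφ'.kerTwo hφ) hd) ∧
    (E.twist d).selmerCorank = (E₀.twist d).selmerCorank ∧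
    (E₀.twist d).selmerCorank = φ.divRank (kerTwo hφ) hd + φ'.divRank (hφ'.kerTwo hφ) hd := by
  have := twist_isElliptic E hd
  have := twist_isElliptic E₀ hd
  have hcomp := φ.twistHom_twistHom hd hφ hφ'
  have hcomp' := φ.twistHom_twistHom' hd hφ hφ'
  have hsurj := φ.twistHom_surjective hd hφ hφ'
  have hsurj' := φ.twistHom_dual_surjective hd hφ hφ'
  have hker : Nat.card (φ.twistHom hd).ker = 2 := (φ.card_ker_twistHom hd).trans hφ
  have : Finite (φ.twistHom hd).ker := Nat.finite_of_card_ne_zero (hker.trans_ne two_ne_zero)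
  obtain ⟨_, hker'⟩ := φ.card_ker_twistHom_dual_le hd hφ hφ'
  have hf := finite_selmer_inf_ker rfl rfl (φ.twistHom_smul hd) hcomp hsurj hker.le
  have hf' := finite_selmer_inf_ker rfl rfl (φ'.twistHom_smul hd) hcomp' hsurj' hker'
  obtain ⟨hex, hrk⟩ := two_pow_selmerCorank_eq (φ.twistHom_smul hd) (φ'.twistHom_smul hd) hcomp
    hcomp' (φ.extendsLocally_twistHom hd) (φ'.extendsLocally_twistHom hd) hf hf'
  obtain ⟨hex', hrk'⟩ := two_pow_selmerCorank_eq (φ'.twistHom_smul hd) (φ.twistHom_smul hd) hcomp'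
    hcomp (φ'.extendsLocally_twistHom hd) (φ.extendsLocally_twistHom hd) hf' hf
  obtain ⟨hfin, hcard⟩ := φ.finite_divPart_and_card hd (kerTwo hφ) hcomp hsurj hf
  obtain ⟨hfin', hcard'⟩ := φ'.finite_divPart_and_card hd (hφ'.kerTwo hφ) hcomp' hsurj' hf'
  -- Both coranks are now exponents of the same product of kernel orders, with the factors in
  -- opposite order.
  rw [hcard, hcard', ← pow_add] at hrk hrk'
  have e := Nat.pow_right_injective le_rfl hrk
  have e' := Nat.pow_right_injective le_rfl hrk'
  exact ⟨hex, hex', hfin, hfin', by rw [e, e', add_comm], by rw [e', add_comm]⟩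

end Isogeny

end WeierstrassCurve

end

theorem proposition1p12 (E E₀ : WeierstrassCurve ℚ) [E.IsElliptic] [E₀.IsElliptic]
    (φ : WeierstrassCurve.Isogeny E E₀) (hφ : φ.degree = 2)
    (φ' : WeierstrassCurve.Isogeny E₀ E) (hφ' : φ.IsDual φ')
    (d : ℤ) (hd : d ≠ 0) :
    (E.twist d).SelmerCorankExists ∧ (E₀.twist d).SelmerCorankExists ∧
    Module.Finite (ZMod 2)
      (φ.divPart (WeierstrassCurve.Isogeny.kerTwo hφ) (Int.cast_ne_zero (α := ℚ).2 hd)) ∧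
    Module.Finite (ZMod 2) (φ'.divPart (hφ'.kerTwo hφ) (Int.cast_ne_zero (α := ℚ).2 hd)) ∧
    (E.twist d).selmerCorank = (E₀.twist d).selmerCorank ∧
    (E₀.twist d).selmerCorank =
      φ.divRank (WeierstrassCurve.Isogeny.kerTwo hφ) (Int.cast_ne_zero (α := ℚ).2 hd) +
        φ'.divRank (hφ'.kerTwo hφ) (Int.cast_ne_zero (α := ℚ).2 hd) :=
  φ.selmerCorank_twist_eq hφ φ' hφ' (Int.cast_ne_zero.2 hd)
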